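/- Let $q>p\ge 0$ be even integers. For a finite connected graph $G$ with distance function $\rho$, the polygraph $G_S$, $S=[p,q,p+q]$, has vertex set $V(G)^3$, and $(x_1,x_2,x_3)$, $(y_1,y_2,y_3)$ are adjacent iff the multisets $[\rho(x_1,y_1),\rho(x_2,y_2),\rho(x_3,y_3)]$ and $[p,q,p+q]$ coincide. The link of a vertex is the subgraph induced on its set of neighbors; a graph is $(a,b)$-regular ($a>b\ge0$) if it is $a$-regular and all its links are $b$-regular. A $d$-regular graph ($d>0$) whose adjacency matrix has eigenvalues $d=\lambda_1\ge\lambda_2\ge\dots\ge\lambda_n$ is an $\epsilon$-spectral expander if $1-\lambda_2/d\ge\epsilon$. Write $\gamma(G)=1-\max\{\lambda_2,-\lambda_n\}/d$ for its (two-sided) normalized spectral gap. There are functions $a,b:\mathbb N\to\mathbb N$, a constant $\epsilon>0$ and a function $\epsilon':\mathbb R\to\mathbb R$ that is positive on $(0,\infty)$, all depending only on $p$ and $q$, such that the following holds for every $d\ge 3$ and every finite $d$-regular graph $G$ that is connected, non-bipartite and of girth bigger than $3p+3q$: the polygraph $G_{[p,q,p+q]}$ is $(a(d),b(d))$-regular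 with $b(d)>0$; each of its links is an $\epsilon$-spectral expander; and $\gamma(G)>0$, and $G_{[p,q,p+q]}$ is an $\epsilon'(\gamma)$-spectral expander for every $0<\gamma\le\gamma(G)$. -/

import Mathlib

universe u

/-- The polygraph `G_S` on `V^m`: two `m`-tuples are adjacent iff the multiset of their coordinatewise
graph distances is `S`. (The clause `x ≠ y` only matters when all members of `S` are zero, where it
removes the loops.) -/
def polygraph {V : Type*} (G : SimpleGraph V) {m : ℕ} (S : Multiset ℕ) :
    SimpleGraph (Fin m → V) where
  Adj x y := x ≠ y ∧ (Finset.univ : Finset (Fin m)).val.map (fun i => G.dist (x i) (y i)) = S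
  symm := ⟨fun x y h => ⟨h.1.symm, by simpa only [SimpleGraph.dist_comm] using h.2⟩⟩
  loopless := ⟨fun _ h => h.1 rfl⟩

/-- The link of `v`: the subgraph induced on the set of neighbours of `v`. -/
abbrev link {V : Type*} (G : SimpleGraph V) (v : V) : SimpleGraph (G.neighborSet v) :=
  G.induce (G.neighborSet v)

open Classical in
/-- `G` is `(a,b)`-regular: `a > b ≥ 0`, `G` is `a`-regular and all its links are `b`-regular. -/
def IsABRegular {V : Type*} [Fintype V] (G : SimpleGraph V) (a b : ℕ) : Prop :=
  b < a ∧ G.IsRegularOfDegree a ∧ ∀ v : V, (link G v).IsRegularOfDegree b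

open Classical in
/-- The eigenvalues `λ_1 ≥ λ_2 ≥ … ≥ λ_n` of the adjacency matrix, with multiplicity;
`adjEigenvalue G k` is `λ_k` for `1 ≤ k ≤ n` (and `0` for other `k`). -/
noncomputable def adjEigenvalue {V : Type*} [Fintype V] (G : SimpleGraph V) (k : ℕ) : ℝ :=
  if h : 1 ≤ k ∧ k ≤ Fintype.card V then
    (G.isHermitian_adjMatrix ℝ).eigenvalues₀ ⟨k - 1, by omega⟩
  else 0

open Classical in
/-- `G` is a `d`-regular `ε`-spectral expander: `1 - λ_2 / d ≥ ε`. The degree is positive, so that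
the normalized gap makes sense. -/
def IsSpectralExpander {V : Type*} [Fintype V] (G : SimpleGraph V) (d : ℕ) (ε : ℝ) : Prop :=
  0 < d ∧ G.IsRegularOfDegree d ∧ ε ≤ 1 - adjEigenvalue G 2 / d

open Classical in
/-- All links of `G` are `b`-regular `ε`-spectral expanders. -/
def IsLocalSpectralExpander {V : Type*} [Fintype V] (G : SimpleGraph V) (b : ℕ) (ε : ℝ) : Prop :=
  ∀ v : V, IsSpectralExpander (link G v) b ε

/-- `λ(G) = max {λ_2, -λ_n}`. -/
noncomputable def lambdaMax {V : Type*} [Fintype V] (G : SimpleGraph V) : ℝ :=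
  max (adjEigenvalue G 2) (-adjEigenvalue G (Fintype.card V))

/-- The normalized spectral gap `1 - λ(G) / d` of a `d`-regular graph, where
`λ(G) = max {λ_2, -λ_n}`. -/
noncomputable def spectralGap {V : Type*} [Fintype V] (G : SimpleGraph V) (d : ℕ) : ℝ :=
  1 - lambdaMax G / d

/-!
In a graph of girth larger than `g`, closed walks of length at most `g` behave as in a tree, so the
number of vertices at prescribed distances from two or three points depends only on `d` and on the
distances between the points. This gives the regularity of the polygraph and of its links.

A link is a graph on triples of spheres of `G`. A suitable walk of eight steps in it lets each
coordinate forget where it started: the number of walks between two given vertices is bounded below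
by a fixed proportion of the mean. The eighth power of the adjacency matrix is thus a positive
multiple of the all-ones matrix plus a nonnegative matrix, and the Perron argument bounds the
nontrivial eigenvalues away from the degree, uniformly in `d`.

Products `y ↦ ∏ f i (y i)` of eigenfunctions of `G` form an eigenbasis of the polygraph, the
eigenvalues being sums over arrangements of products of spherical functions of the `d`-regular tree.
Unless all `f i` are constant, one factor has absolute value at most `1 - 3γ/8`.
-/

open Finset Matrix

section Girth

variable {V : Type*} {G : SimpleGraph V}

theorem isAcyclic_of_encard_edgeSet_lt_egirth {H : SimpleGraph V} (hHG : H ≤ G)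
    (hH : H.edgeSet.encard < G.egirth) : H.IsAcyclic := by
  classical
  intro v c hc
  refine hH.not_ge <| (SimpleGraph.egirth_anti hHG).trans <|
    (SimpleGraph.egirth_le_length hc).trans ?_
  rw [← c.length_edges, ← List.toFinset_card_of_nodup hc.isCircuit.isTrail.edges_nodup,
    ← Set.encard_coe_eq_coe_finsetCard]
  exact Set.encard_le_encard fun e he => c.edges_subset_edgeSet (List.mem_toFinset.mp he)

theorem walk_eq_of_isChain_edges {u v : V} {p q : G.Walk u v} (hp : p.edges.IsChain (· ≠ ·))
    (hq : q.edges.IsChain (· ≠ ·)) (h : ((p.length + q.length : ℕ) : ℕ∞) < G.egirth) : p = q := by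
  classical
  set H : SimpleGraph V := SimpleGraph.fromEdgeSet ((p.edges ++ q.edges).toFinset : Set (Sym2 V))
    with hHdef
  have hHE : H.edgeSet = ((p.edges ++ q.edges).toFinset : Set (Sym2 V)) := by
    rw [hHdef, SimpleGraph.edgeSet_fromEdgeSet, sdiff_eq_left, Set.disjoint_left]
    intro e he
    refine G.not_isDiag_of_mem_edgeSet ?_
    rw [List.coe_toFinset, Set.mem_ofPred_eq, List.mem_append] at he
    exact he.elim (p.edges_subset_edgeSet ·) (q.edges_subset_edgeSet ·)
  have hmem : ∀ e, e ∈ p.edges ∨ e ∈ q.edges ↔ e ∈ H.edgeSet := by simp [hHE]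
  have hpH : ∀ e ∈ p.edges, e ∈ H.edgeSet := fun e he => (hmem e).mp (.inl he)
  have hqH : ∀ e ∈ q.edges, e ∈ H.edgeSet := fun e he => (hmem e).mp (.inr he)
  have hHG : H ≤ G := SimpleGraph.edgeSet_subset_edgeSet.mp fun e he =>
    ((hmem e).mpr he).elim (p.edges_subset_edgeSet ·) (q.edges_subset_edgeSet ·)
  have hcard : H.edgeSet.encard ≤ ((p.length + q.length : ℕ) : ℕ∞) := by
    rw [hHE, Set.encard_coe_eq_coe_finsetCard, ← p.length_edges, ← q.length_edges,
      ← List.length_append]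
    exact_mod_cast List.toFinset_card_le _
  have hacyc := isAcyclic_of_encard_edgeSet_lt_egirth hHG (hcard.trans_lt h)
  have hpath : p.transfer H hpH = q.transfer H hqH :=
    congrArg Subtype.val <| (hacyc.subsingleton_path u v).elim
      ⟨_, (hacyc.isPath_iff_isChain _).mpr (by rwa [SimpleGraph.Walk.edges_transfer])⟩
      ⟨_, (hacyc.isPath_iff_isChain _).mpr (by rwa [SimpleGraph.Walk.edges_transfer])⟩
  refine SimpleGraph.Walk.ext_support ?_
  rw [← p.support_transfer hpH, ← q.support_transfer hqH, hpath]

theorem isChain_edges_of_length_eq_dist {u v : V} (p : G.Walk u v) (hp : p.length = G.dist u v) :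
    p.edges.IsChain (· ≠ ·) :=
  (p.isPath_of_length_eq_dist hp).isTrail.edges_nodup.isChain

theorem isChain_edges_append {u v w z z' : V} (h : G.Adj w z) (h' : G.Adj z z') {p : G.Walk u w}
    {q : G.Walk z' v} (hp : (p.concat h).edges.IsChain (· ≠ ·))
    (hq : (q.cons h').edges.IsChain (· ≠ ·)) (hne : w ≠ z') :
    ((p.concat h).append (q.cons h')).edges.IsChain (· ≠ ·) := by
  rw [SimpleGraph.Walk.edges_concat, List.concat_eq_append] at hp
  rw [SimpleGraph.Walk.edges_cons] at hq
  rw [SimpleGraph.Walk.edges_append, SimpleGraph.Walk.edges_concat, SimpleGraph.Walk.edges_cons,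
    List.concat_eq_append, List.append_assoc, List.singleton_append, List.isChain_append_cons_cons]
  refine ⟨hp, ?_, hq⟩
  rw [Sym2.eq_swap, ne_eq, Sym2.congr_right]
  exact hne

end Girth

section Distance

variable {V : Type*} {G : SimpleGraph V}

theorem exists_adj_dist_add_one (hc : G.Connected) {x z : V} (h : x ≠ z) :
    ∃ w, G.Adj z w ∧ G.dist x w + 1 = G.dist x z := by
  obtain ⟨p, hp⟩ := hc.exists_walk_length_eq_dist z x
  cases p with
  | nil => exact absurd rfl h
  | @cons _ w _ hzw p =>
    refine ⟨w, hzw, ?_⟩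
    rw [SimpleGraph.Walk.length_cons] at hp
    have hpw := SimpleGraph.dist_le p
    have hzx := hzw.symm.diff_dist_adj (u := x)
    rw [SimpleGraph.dist_comm] at hp hpw
    lia

theorem exists_walk_concat_length_eq_dist (hc : G.Connected) {x z w : V} (hw : G.Adj w z)
    (hd : G.dist x w + 1 = G.dist x z) :
    ∃ p : G.Walk x w, (p.concat hw).length = G.dist x z := by
  obtain ⟨p, hp⟩ := hc.exists_walk_length_eq_dist x w
  exact ⟨p, by rw [SimpleGraph.Walk.length_concat, hp, hd]⟩

variable {g : ℕ}

theorem dist_ne_of_adj (hc : G.Connected) (hg : (g : ℕ∞) < G.egirth) {x z w : V}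
    (h : 2 * G.dist x z < g) (hw : G.Adj z w) : G.dist x w ≠ G.dist x z := by
  intro heq
  obtain ⟨p, hp⟩ := hc.exists_walk_length_eq_dist x w
  obtain ⟨p', hp'⟩ := hc.exists_walk_length_eq_dist x z
  have hz : z ∉ p.support := by
    classical
    intro hz
    have hle := SimpleGraph.dist_le (p.takeUntil z hz)
    have hlt := SimpleGraph.Walk.length_takeUntil_lt_length hz hw.ne
    lia
  have hpath := (p.isPath_of_length_eq_dist hp).concat hz hw.symm
  have hpp' := walk_eq_of_isChain_edges hpath.isTrail.edges_nodup.isChain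
    (isChain_edges_of_length_eq_dist p' hp') (lt_of_le_of_lt
      (Nat.cast_le.mpr (by rw [SimpleGraph.Walk.length_concat]; lia)) hg)
  have hlen := congrArg SimpleGraph.Walk.length hpp'
  rw [SimpleGraph.Walk.length_concat] at hlen
  lia

/- Otherwise the geodesics from `x` to `w` and from `w'` to `y`, joined through `z`, would not
backtrack, so they would form the geodesic from `x` to `y`. -/
theorem parent_eq (hc : G.Connected) (hg : (g : ℕ∞) < G.egirth) {x y z w w' : V}
    (hlt : G.dist x y < G.dist x z + G.dist y z)
    (hper : G.dist x y + G.dist x z + G.dist y z ≤ g) (hw : G.Adj z w) (hw' : G.Adj z w')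
    (hd : G.dist x w + 1 = G.dist x z) (hd' : G.dist y w' + 1 = G.dist y z) : w = w' := by
  by_contra hne
  obtain ⟨p, hp⟩ := exists_walk_concat_length_eq_dist hc hw.symm hd
  obtain ⟨p', hp'⟩ := exists_walk_concat_length_eq_dist hc hw'.symm hd'
  obtain ⟨r, hr⟩ := hc.exists_walk_length_eq_dist x y
  have hp'r : (p'.reverse.cons hw').length = G.dist z y := by
    rw [SimpleGraph.dist_comm, ← hp', SimpleGraph.Walk.length_cons,
      SimpleGraph.Walk.length_reverse, SimpleGraph.Walk.length_concat]
  have hlen : ((p.concat hw.symm).append (p'.reverse.cons hw')).length =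
      G.dist x z + G.dist y z := by
    rw [SimpleGraph.Walk.length_append, hp, hp'r, SimpleGraph.dist_comm (u := z)]
  have hchain := isChain_edges_append hw.symm hw' (isChain_edges_of_length_eq_dist _ hp)
    (isChain_edges_of_length_eq_dist _ hp'r) hne
  have heq := walk_eq_of_isChain_edges hchain (isChain_edges_of_length_eq_dist r hr)
    (lt_of_le_of_lt (Nat.cast_le.mpr (by lia)) hg)
  have := congrArg SimpleGraph.Walk.length heq
  lia

theorem parent_unique (hc : G.Connected) (hg : (g : ℕ∞) < G.egirth) {x z w w' : V}
    (h : 2 * G.dist x z ≤ g) (hw : G.Adj z w) (hw' : G.Adj z w')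
    (hd : G.dist x w + 1 = G.dist x z) (hd' : G.dist x w' + 1 = G.dist x z) : w = w' :=
  parent_eq hc hg (by rw [SimpleGraph.dist_self]; lia) (by rw [SimpleGraph.dist_self]; lia)
    hw hw' hd hd'

end Distance

/-- The number of neighbours farther than `w` from both `x` and `y`, when the `d`-regular tree has
`x` and `y` at distances `α` and `β` from the centre of the tripod `x`, `y`, `w` and `w` at distance
`κ` from it. -/
def childCount (d α β κ : ℕ) : ℕ :=
  if κ = 0 then d - (if α = 0 then 0 else 1) - (if β = 0 then 0 else 1) else d - 1

/-- The number of vertices at distances `α + κ` and `β + κ` from two vertices at distance `α + β` in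
the `d`-regular tree. -/
def tripodCount (d α β κ : ℕ) : ℕ :=
  ∏ i ∈ range κ, childCount d α β i

/-- The number of vertices at distance `r` from a vertex of the `d`-regular tree. -/
def sphereCount (d r : ℕ) : ℕ :=
  tripodCount d 0 0 r

/-- The number of vertices at distances `j` and `k` from two vertices at distance `i` in the
`d`-regular tree. Only meant for even `i + j + k`: the tree is bipartite, so that the number is zero
otherwise. -/
def triangleCount (d i j k : ℕ) : ℕ :=
  if i ≤ j + k ∧ j ≤ i + k ∧ k ≤ i + j then
    tripodCount d ((i + j - k) / 2) ((i + k - j) / 2) ((j + k - i) / 2)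
  else 0

theorem sphereCount_zero (d : ℕ) : sphereCount d 0 = 1 := rfl

theorem sphereCount_succ (d r : ℕ) : sphereCount d (r + 1) = d * (d - 1) ^ r := by
  simp [sphereCount, tripodCount, prod_range_succ', childCount, mul_comm]

theorem pow_le_sphereCount (d r : ℕ) : (d - 1) ^ r ≤ sphereCount d r := by
  cases r with
  | zero => rfl
  | succ r =>
    rw [sphereCount_succ, pow_succ']
    gcongr
    exact d.sub_le 1

section Counting

variable {V : Type*} [Fintype V] {G : SimpleGraph V} {g d : ℕ}

theorem card_geodesic (hc : G.Connected) (hg : (g : ℕ∞) < G.egirth) {x : V} {α β : ℕ} :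
    ∀ {y : V}, G.dist x y = α + β → 2 * (α + β) ≤ g →
      #{z | G.dist x z = α ∧ G.dist y z = β} = 1 := by
  induction β with
  | zero =>
    intro y hxy _
    refine card_eq_one.mpr ⟨y, ?_⟩
    ext z
    simp only [mem_filter_univ, mem_singleton, hc.dist_eq_zero_iff]
    exact ⟨fun h => h.2.symm, fun h => ⟨h ▸ hxy, h.symm⟩⟩
  | succ β ih =>
    intro y hxy hg'
    have hne : x ≠ y := by rintro rfl; simp at hxy
    obtain ⟨y', hy', hd'⟩ := exists_adj_dist_add_one hc hne
    refine Eq.trans ?_ (ih (y := y') (by lia) (by lia))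
    congr 1
    ext z
    simp only [mem_filter_univ, and_congr_right_iff]
    rintro rfl
    have hyz := hy'.diff_dist_adj (u := z)
    have htri := hc.dist_triangle (u := x) (v := z) (w := y')
    simp only [G.dist_comm (v := z)] at *
    refine ⟨fun hz => ?_, fun hz => ?_⟩
    · have hzy : z ≠ y := by rintro rfl; simp at hz
      obtain ⟨v, hv, hdv⟩ := exists_adj_dist_add_one hc hzy
      have hxv := hc.dist_triangle (u := x) (v := z) (w := v)
      have hvy := hv.diff_dist_adj (u := x)
      simp only [G.dist_comm (v := z)] at *
      obtain rfl := parent_unique hc hg (by lia) hv hy' (by lia) hd'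
      lia
    · have := hc.dist_triangle (u := x) (v := z) (w := y)
      simp only [G.dist_comm (v := z)] at *
      lia

variable [DecidableRel G.Adj]

theorem card_parents (hc : G.Connected) (hg : (g : ℕ∞) < G.egirth) {x w : V}
    (h : 2 * G.dist x w ≤ g) :
    #{z ∈ G.neighborFinset w | G.dist x z + 1 = G.dist x w} =
      if G.dist x w = 0 then 0 else 1 := by
  split_ifs with h0
  · simp [h0]
  · have hne : x ≠ w := by rintro rfl; simp at h0
    obtain ⟨v, hv, hdv⟩ := exists_adj_dist_add_one hc hne
    refine card_eq_one.mpr ⟨v, ?_⟩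
    ext z
    rw [mem_filter, SimpleGraph.mem_neighborFinset, mem_singleton]
    exact ⟨fun hz => parent_unique hc hg h hz.1 hv hz.2 hdv, fun hz => hz ▸ ⟨hv, hdv⟩⟩

theorem card_parents_union [DecidableEq V] (hc : G.Connected) (hg : (g : ℕ∞) < G.egirth)
    {x y w : V} {α β κ : ℕ} (hxy : G.dist x y = α + β) (hx : G.dist x w = α + κ)
    (hy : G.dist y w = β + κ) (hper : 2 * (α + β + κ) ≤ g) :
    #({z ∈ G.neighborFinset w | G.dist x z + 1 = G.dist x w} ∪
        {z ∈ G.neighborFinset w | G.dist y z + 1 = G.dist y w}) =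
      if κ = 0 then (if α = 0 then 0 else 1) + (if β = 0 then 0 else 1) else 1 := by
  have cx := card_parents hc hg (x := x) (w := w) (by lia)
  have cy := card_parents hc hg (x := y) (w := w) (by lia)
  by_cases hκ : κ = 0
  · rw [if_pos hκ, card_union_of_disjoint, cx, cy, hx, hy, hκ, add_zero, add_zero]
    rw [disjoint_left]
    intro z hz hz'
    have := hc.dist_triangle (u := x) (v := z) (w := y)
    rw [mem_filter] at hz hz'
    rw [G.dist_comm (u := z)] at this
    lia
  · rw [if_neg (by lia), card_eq_one] at cx cy
    rw [if_neg hκ]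
    obtain ⟨u, hu⟩ := cx
    obtain ⟨v, hv⟩ := cy
    have hu' := hu ▸ mem_singleton_self u
    have hv' := hv ▸ mem_singleton_self v
    rw [mem_filter, SimpleGraph.mem_neighborFinset] at hu' hv'
    obtain rfl := parent_eq hc hg (by lia) (by lia) hu'.1 hv'.1 hu'.2 hv'.2
    rw [hu, hv, union_self, card_singleton]

theorem card_children (hc : G.Connected) (hg : (g : ℕ∞) < G.egirth)
    (hreg : G.IsRegularOfDegree d) {x y w : V} {α β κ : ℕ} (hxy : G.dist x y = α + β)
    (hx : G.dist x w = α + κ) (hy : G.dist y w = β + κ) (hper : 2 * (α + β + κ) < g) :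
    #{z ∈ G.neighborFinset w | G.dist x z = α + (κ + 1) ∧ G.dist y z = β + (κ + 1)} =
      childCount d α β κ := by
  classical
  have hset : {z ∈ G.neighborFinset w | G.dist x z = α + (κ + 1) ∧ G.dist y z = β + (κ + 1)} =
      G.neighborFinset w \ ({z ∈ G.neighborFinset w | G.dist x z + 1 = G.dist x w} ∪
        {z ∈ G.neighborFinset w | G.dist y z + 1 = G.dist y w}) := by
    ext z
    simp only [mem_filter, mem_sdiff, mem_union, SimpleGraph.mem_neighborFinset]
    refine ⟨fun h => ⟨h.1, by lia⟩, fun h => ⟨h.1, ?_⟩⟩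
    have hxz := h.1.diff_dist_adj (u := x)
    have hyz := h.1.diff_dist_adj (u := y)
    have hxne := dist_ne_of_adj hc hg (x := x) (by lia) h.1
    have hyne := dist_ne_of_adj hc hg (x := y) (by lia) h.1
    lia
  rw [hset, card_sdiff_of_subset (union_subset (filter_subset _ _) (filter_subset _ _)),
    card_parents_union hc hg hxy hx hy hper.le, SimpleGraph.card_neighborFinset_eq_degree, hreg w,
    childCount]
  split_ifs <;> rfl

theorem card_common_parents (hc : G.Connected) (hg : (g : ℕ∞) < G.egirth) {x y z : V}
    {α β κ : ℕ} (hxy : G.dist x y = α + β) (hx : G.dist x z = α + (κ + 1))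
    (hy : G.dist y z = β + (κ + 1)) (hper : 2 * (α + β + (κ + 1)) ≤ g) :
    #{w ∈ G.neighborFinset z | G.dist x w = α + κ ∧ G.dist y w = β + κ} = 1 := by
  obtain ⟨w, hw, hdw⟩ := exists_adj_dist_add_one hc (x := x) (z := z) (by rintro rfl; simp at hx)
  obtain ⟨w', hw', hdw'⟩ := exists_adj_dist_add_one hc (x := y) (z := z) (by rintro rfl; simp at hy)
  obtain rfl := parent_eq hc hg (by lia) (by lia) hw hw' hdw hdw'
  refine card_eq_one.mpr ⟨w, ?_⟩
  ext v
  rw [mem_filter, SimpleGraph.mem_neighborFinset, mem_singleton]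
  refine ⟨fun hv => parent_unique hc hg (x := x) (by lia) hv.1 hw (by lia) hdw, ?_⟩
  rintro rfl
  exact ⟨hw, by lia, by lia⟩

theorem card_tripod (hc : G.Connected) (hg : (g : ℕ∞) < G.egirth) (hreg : G.IsRegularOfDegree d)
    {x y : V} {α β κ : ℕ} (hxy : G.dist x y = α + β) (hper : 2 * (α + β + κ) ≤ g) :
    #{z | G.dist x z = α + κ ∧ G.dist y z = β + κ} = tripodCount d α β κ := by
  induction κ with
  | zero => exact card_geodesic hc hg hxy hper
  | succ κ ih =>
    have hcount := card_mul_eq_card_mul G.Adj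
      (s := ({z | G.dist x z = α + κ ∧ G.dist y z = β + κ} : Finset V))
      (t := ({z | G.dist x z = α + (κ + 1) ∧ G.dist y z = β + (κ + 1)} : Finset V))
      (m := childCount d α β κ) (n := 1)
      (fun w hw => by
        rw [mem_filter_univ] at hw
        rw [← card_children hc hg hreg hxy hw.1 hw.2 (by lia)]
        congr 1
        ext z
        simp only [bipartiteAbove, mem_filter, mem_univ, true_and, SimpleGraph.mem_neighborFinset]
        tauto)
      (fun z hz => by
        rw [mem_filter_univ] at hz
        rw [← card_common_parents hc hg hxy hz.1 hz.2 hper]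
        congr 1
        ext w
        simp only [bipartiteBelow, mem_filter, mem_univ, true_and, SimpleGraph.mem_neighborFinset,
          G.adj_comm z]
        tauto)
    rw [tripodCount, prod_range_succ, ← tripodCount, ← ih (by lia), hcount, mul_one]

theorem card_sphere (hc : G.Connected) (hg : (g : ℕ∞) < G.egirth) (hreg : G.IsRegularOfDegree d)
    {r : ℕ} (hr : 2 * r ≤ g) (x : V) : #{z | G.dist x z = r} = sphereCount d r := by
  simpa [sphereCount] using
    card_tripod hc hg hreg (x := x) (y := x) (α := 0) (β := 0) (κ := r) (by simp) (by lia)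

theorem card_triangle (hc : G.Connected) (hg : (g : ℕ∞) < G.egirth)
    (hreg : G.IsRegularOfDegree d) {x y : V} {j k : ℕ} (heven : Even (G.dist x y + j + k))
    (hper : G.dist x y + j + k ≤ g) :
    #{z | G.dist x z = j ∧ G.dist y z = k} = triangleCount d (G.dist x y) j k := by
  rw [triangleCount]
  obtain ⟨m, hm⟩ := heven
  split_ifs with h
  · rw [← card_tripod hc hg hreg (x := x) (y := y) (by lia) (by lia)]
    congr! 4 <;> lia
  · rw [card_eq_zero, filter_eq_empty_iff]
    rintro z - ⟨rfl, rfl⟩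
    have h₁ := hc.dist_triangle (u := x) (v := z) (w := y)
    have h₂ := hc.dist_triangle (u := x) (v := y) (w := z)
    have h₃ := hc.dist_triangle (u := y) (v := x) (w := z)
    simp only [G.dist_comm (u := z), G.dist_comm (u := y) (v := x)] at h₁ h₃
    lia

theorem card_not_opposite_le (hc : G.Connected) (hg : (g : ℕ∞) < G.egirth)
    (hreg : G.IsRegularOfDegree d) {o y : V} {t : ℕ} (hper : 2 * (G.dist o y + (t + 1)) ≤ g) :
    #{w | G.dist o w = t + 1 ∧ G.dist y w ≠ G.dist o y + (t + 1)} ≤ (d - 1) ^ t := by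
  by_cases hoy : y = o
  · simp +contextual [hoy]
  obtain ⟨o', ho', hd'⟩ := exists_adj_dist_add_one hc hoy
  have htripod : #{w | G.dist o w = 1 + t ∧ G.dist o' w = 0 + t} = (d - 1) ^ t := by
    rw [card_tripod hc hg hreg (SimpleGraph.dist_eq_one_iff_adj.mpr ho')
      (by rw [G.dist_comm (v := o)] at hd'; lia), tripodCount, prod_eq_pow_card, card_range]
    intro i _
    simp [childCount]
  rw [← htripod]
  refine card_le_card fun w hw => ?_
  rw [mem_filter_univ] at hw ⊢
  obtain ⟨v, hv, hdv⟩ := exists_adj_dist_add_one hc (x := w) (z := o) (by rintro rfl; simp at hw)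
  have htri := hc.dist_triangle (u := y) (v := o) (w := w)
  have howc : G.dist w o = G.dist o w := G.dist_comm
  have hoyc : G.dist y o = G.dist o y := G.dist_comm
  obtain rfl := parent_eq hc hg (x := y) (y := w) (by lia) (by lia) ho' hv hd' hdv
  rw [G.dist_comm (u := o')]
  lia

theorem pow_le_two_mul_card_opposite (hc : G.Connected) (hg : (g : ℕ∞) < G.egirth)
    (hreg : G.IsRegularOfDegree d) (hd : 3 ≤ d) {o y y' : V} {t : ℕ}
    (hy : 2 * (G.dist o y + t) ≤ g) (hy' : 2 * (G.dist o y' + t) ≤ g) :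
    (d - 1) ^ t ≤
      2 * #{w | G.dist o w = t ∧ G.dist y w = G.dist o y + t ∧ G.dist y' w = G.dist o y' + t} := by
  classical
  cases t with
  | zero =>
    refine Nat.mul_pos two_pos (card_pos.mpr ⟨o, ?_⟩)
    simp [G.dist_comm (v := o)]
  | succ t =>
    have hcover : ({w | G.dist o w = t + 1} : Finset V) ⊆
        ({w | G.dist o w = t + 1 ∧ G.dist y w = G.dist o y + (t + 1) ∧
          G.dist y' w = G.dist o y' + (t + 1)} : Finset V) ∪
        (({w | G.dist o w = t + 1 ∧ G.dist y w ≠ G.dist o y + (t + 1)} : Finset V) ∪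
        ({w | G.dist o w = t + 1 ∧ G.dist y' w ≠ G.dist o y' + (t + 1)} : Finset V)) := by
      intro w hw
      simp only [mem_union, mem_filter_univ] at hw ⊢
      tauto
    have hunion := (card_le_card hcover).trans <| (card_union_le _ _).trans <|
      Nat.add_le_add_left ((card_union_le _ _).trans <| Nat.add_le_add
        (card_not_opposite_le hc hg hreg hy) (card_not_opposite_le hc hg hreg hy')) _
    rw [card_sphere hc hg hreg (by lia), sphereCount_succ] at hunion
    obtain ⟨e, rfl⟩ := Nat.exists_eq_add_of_le' hd
    rw [show e + 3 - 1 = e + 2 from rfl, pow_succ] at *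
    nlinarith [Nat.zero_le (e * (e + 2) ^ t)]

end Counting

section Eigenvectors

variable {V : Type*} [Fintype V]

theorem pow_mulVec_eq_pow_smul [DecidableEq V] {M : Matrix V V ℝ} {f : V → ℝ} {μ : ℝ}
    (h : M *ᵥ f = μ • f) (k : ℕ) : (M ^ k) *ᵥ f = μ ^ k • f := by
  induction k with
  | zero => simp
  | succ k ih => rw [pow_succ, ← mulVec_mulVec, h, mulVec_smul, ih, smul_smul, pow_succ, mul_comm]

/- On vectors of sum zero, `M` acts as `M` minus the constant matrix `m`, whose entries are
nonnegative and whose row sums are smaller. -/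
theorem abs_eigenvalue_le_of_forall_le {M : Matrix V V ℝ} {m b : ℝ} (hm : ∀ y z, m ≤ M y z)
    (hrow : ∀ y, ∑ z, M y z = b) {f : V → ℝ} {μ : ℝ} (hf : f ≠ 0) (hs : ∑ x, f x = 0)
    (h : M *ᵥ f = μ • f) : |μ| ≤ b - m * Fintype.card V := by
  obtain ⟨x, hx⟩ := Function.ne_iff.mp hf
  obtain ⟨y, -, hy⟩ := exists_max_image univ (fun y => |f y|) ⟨x, mem_univ x⟩
  have hpos : 0 < |f y| := (abs_pos.mpr hx).trans_le (hy x (mem_univ x))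
  have hfy : ∑ z, M y z * f z = μ * f y := congrFun h y
  have hshift : ∑ z, (M y z - m) * f z = μ * f y := by
    simp_rw [sub_mul, sum_sub_distrib, hfy, ← mul_sum, hs, mul_zero, sub_zero]
  refine le_of_mul_le_mul_right ?_ hpos
  calc |μ| * |f y| = |∑ z, (M y z - m) * f z| := by rw [hshift, abs_mul]
    _ ≤ ∑ z, (M y z - m) * |f y| := by
        refine (abs_sum_le_sum_abs _ _).trans (sum_le_sum fun z _ => ?_)
        rw [abs_mul, abs_of_nonneg (sub_nonneg.mpr (hm y z))]
        exact mul_le_mul_of_nonneg_left (hy z (mem_univ z)) (sub_nonneg.mpr (hm y z))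
    _ = (b - m * Fintype.card V) * |f y| := by
        rw [← sum_mul, sum_sub_distrib, hrow, sum_const, card_univ, nsmul_eq_mul, mul_comm m]

theorem abs_eigenvalue_pow_le_of_forall_le_pow [DecidableEq V] {M : Matrix V V ℝ} {m b : ℝ}
    {k : ℕ} (hm : ∀ y z, m ≤ (M ^ k) y z) (hrow : ∀ y, ∑ z, M y z = b) {f : V → ℝ} {μ : ℝ}
    (hf : f ≠ 0) (hs : ∑ x, f x = 0) (h : M *ᵥ f = μ • f) :
    |μ| ^ k ≤ b ^ k - m * Fintype.card V := by
  have hone : M *ᵥ 1 = b • 1 := by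
    ext y
    simp [mulVec, dotProduct, hrow]
  rw [← abs_pow]
  refine abs_eigenvalue_le_of_forall_le hm (fun y => ?_) hf hs (pow_mulVec_eq_pow_smul h k)
  simpa [mulVec, dotProduct] using congrFun (pow_mulVec_eq_pow_smul hone k) y

end Eigenvectors

section Spectral

variable {V : Type*} {G : SimpleGraph V}

theorem eq_of_forall_adj_eq {β : Type*} (hc : G.Connected) {f : V → β}
    (hf : ∀ x y, G.Adj x y → f x = f y) (x y : V) : f x = f y := by
  obtain ⟨w⟩ := hc.preconnected x y
  induction w with
  | nil => rfl
  | cons h _ ih => exact (hf _ _ h).trans ih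

variable [Fintype V] [DecidableRel G.Adj] {d : ℕ} {f g : V → ℝ} {μ ν s : ℝ}

theorem mul_dotProduct_eq_zero (hf : G.adjMatrix ℝ *ᵥ f = μ • f)
    (hg : G.adjMatrix ℝ *ᵥ g = ν • g) : (μ - ν) * (f ⬝ᵥ g) = 0 := by
  have hsymm : (G.adjMatrix ℝ *ᵥ f) ⬝ᵥ g = f ⬝ᵥ (G.adjMatrix ℝ *ᵥ g) := by
    rw [dotProduct_mulVec, ← mulVec_transpose, SimpleGraph.transpose_adjMatrix]
  rw [hf, hg, smul_dotProduct, dotProduct_smul, smul_eq_mul, smul_eq_mul] at hsymm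
  linarith

theorem adjMatrix_mulVec_one (hreg : G.IsRegularOfDegree d) :
    G.adjMatrix ℝ *ᵥ 1 = (d : ℝ) • 1 := by
  ext v
  simpa using G.adjMatrix_mulVec_const_apply_of_regular (a := (1 : ℝ)) hreg (v := v)

theorem sum_adjMatrix (hreg : G.IsRegularOfDegree d) (x : V) : ∑ y, G.adjMatrix ℝ x y = d := by
  simpa [mulVec, dotProduct] using congrFun (adjMatrix_mulVec_one hreg) x

theorem mul_sum_eq_zero (hreg : G.IsRegularOfDegree d) (hf : G.adjMatrix ℝ *ᵥ f = μ • f) :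
    (μ - d) * ∑ x, f x = 0 := by
  simpa [dotProduct] using mul_dotProduct_eq_zero hf (adjMatrix_mulVec_one hreg)

theorem sum_adjMatrix_mul_sq (hreg : G.IsRegularOfDegree d) (hs : s ^ 2 = 1)
    (hf : G.adjMatrix ℝ *ᵥ f = μ • f) :
    ∑ x, ∑ y, G.adjMatrix ℝ x y * (f x - s * f y) ^ 2 = 2 * (d - s * μ) * ∑ x, f x ^ 2 := by
  have hmul : ∀ x, ∑ y, G.adjMatrix ℝ x y * f y = μ * f x := congrFun hf
  have hdiag : ∑ x, ∑ y, G.adjMatrix ℝ x y * f x ^ 2 = d * ∑ x, f x ^ 2 := by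
    simp_rw [← sum_mul, sum_adjMatrix hreg, ← mul_sum]
  have hdiag' : ∑ x, ∑ y, G.adjMatrix ℝ x y * f y ^ 2 = d * ∑ x, f x ^ 2 := by
    rw [sum_comm, ← hdiag]
    simp only [SimpleGraph.adjMatrix_apply, G.adj_comm]
  have hcross : ∑ x, ∑ y, 2 * s * f x * (G.adjMatrix ℝ x y * f y) =
      2 * s * μ * ∑ x, f x ^ 2 := by
    simp_rw [← mul_sum, hmul, mul_sum]
    exact sum_congr rfl fun x _ => by ring
  have hexpand : ∀ x y, G.adjMatrix ℝ x y * (f x - s * f y) ^ 2 = G.adjMatrix ℝ x y * f x ^ 2 +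
      G.adjMatrix ℝ x y * f y ^ 2 - 2 * s * f x * (G.adjMatrix ℝ x y * f y) := fun x y => by
    linear_combination G.adjMatrix ℝ x y * f y ^ 2 * hs
  simp_rw [hexpand, sum_sub_distrib, sum_add_distrib, hdiag, hdiag', hcross]
  ring

theorem eq_mul_of_adj (hreg : G.IsRegularOfDegree d) (hs : s ^ 2 = 1)
    (hf : G.adjMatrix ℝ *ᵥ f = μ • f) (hμ : d ≤ s * μ) {x y : V} (h : G.Adj x y) :
    f x = s * f y := by
  have hnn : ∀ x y, 0 ≤ G.adjMatrix ℝ x y * (f x - s * f y) ^ 2 := fun x y => by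
    rw [SimpleGraph.adjMatrix_apply]
    positivity
  have hzero : ∑ x, ∑ y, G.adjMatrix ℝ x y * (f x - s * f y) ^ 2 = 0 := by
    refine le_antisymm ?_ (sum_nonneg fun x _ => sum_nonneg fun y _ => hnn x y)
    rw [sum_adjMatrix_mul_sq hreg hs hf]
    have : 0 ≤ ∑ x, f x ^ 2 := sum_nonneg fun x _ => sq_nonneg _
    nlinarith
  have hx := (sum_eq_zero_iff_of_nonneg fun x _ => sum_nonneg fun y _ => hnn x y).mp hzero x
    (mem_univ x)
  have hxy := (sum_eq_zero_iff_of_nonneg fun y _ => hnn x y).mp hx y (mem_univ y)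
  rw [SimpleGraph.adjMatrix_apply, if_pos h, one_mul, sq_eq_zero_iff] at hxy
  exact sub_eq_zero.mp hxy

theorem eq_of_degree_le_eigenvalue (hreg : G.IsRegularOfDegree d) (hc : G.Connected)
    (hf : G.adjMatrix ℝ *ᵥ f = μ • f) (hμ : d ≤ μ) (x y : V) : f x = f y :=
  eq_of_forall_adj_eq hc (fun x y h => by
    simpa using eq_mul_of_adj (s := 1) hreg (one_pow 2) hf (by simpa using hμ) h) x y

theorem eigenvalue_lt_degree (hreg : G.IsRegularOfDegree d) (hc : G.Connected) (hf0 : f ≠ 0)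
    (hsum : ∑ x, f x = 0) (hf : G.adjMatrix ℝ *ᵥ f = μ • f) : μ < d := by
  by_contra! hμ
  obtain ⟨x, hx⟩ := Function.ne_iff.mp hf0
  have hcard : (Fintype.card V : ℝ) ≠ 0 := Nat.cast_ne_zero.mpr (Fintype.card_pos_iff.mpr ⟨x⟩).ne'
  rw [sum_congr rfl fun y _ => eq_of_degree_le_eigenvalue hreg hc hf hμ y x, sum_const, card_univ,
    nsmul_eq_mul] at hsum
  exact hx ((mul_eq_zero.mp hsum).resolve_left hcard)

theorem neg_eigenvalue_lt_degree (hreg : G.IsRegularOfDegree d) (hc : G.Connected)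
    (hb : ¬ G.IsBipartite) (hf0 : f ≠ 0) (hf : G.adjMatrix ℝ *ᵥ f = μ • f) : -μ < d := by
  classical
  by_contra! hμ
  have hadj : ∀ x y, G.Adj x y → f x = -f y := fun x y h => by
    simpa using eq_mul_of_adj (s := -1) hreg (by norm_num) hf (by simpa using hμ) h
  obtain ⟨x, hx⟩ := Function.ne_iff.mp hf0
  have hne : ∀ y, f y ≠ 0 := fun y => by
    have hsq := eq_of_forall_adj_eq hc (f := fun z => f z ^ 2)
      (fun v w h => by simp only [hadj v w h, neg_sq]) x y
    exact fun hy => hx (by simpa [hy] using hsq)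
  refine hb ⟨SimpleGraph.Coloring.mk (fun v => if 0 < f v then (0 : Fin 2) else 1) ?_⟩
  intro v w h
  rcases (hne w).lt_or_gt with hw | hw <;> simp [hadj v w h, hw, hw.le]

theorem exists_sum_eq_zero_eigenvector (hreg : G.IsRegularOfDegree d) (hf0 : f ≠ 0) (hg0 : g ≠ 0)
    (hfg : f ⬝ᵥ g = 0) (hf : G.adjMatrix ℝ *ᵥ f = μ • f) (hg : G.adjMatrix ℝ *ᵥ g = ν • g)
    (hνμ : ν ≤ μ) :
    ∃ (h : V → ℝ) (κ : ℝ), h ≠ 0 ∧ ∑ x, h x = 0 ∧ G.adjMatrix ℝ *ᵥ h = κ • h ∧ ν ≤ κ := by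
  by_cases hsg : ∑ x, g x = 0
  · exact ⟨g, ν, hg0, hsg, hg, le_rfl⟩
  by_cases hsf : ∑ x, f x = 0
  · exact ⟨f, μ, hf0, hsf, hf, hνμ⟩
  have hμ := sub_eq_zero.mp ((mul_eq_zero.mp (mul_sum_eq_zero hreg hf)).resolve_right hsf)
  have hν := sub_eq_zero.mp ((mul_eq_zero.mp (mul_sum_eq_zero hreg hg)).resolve_right hsg)
  refine ⟨(∑ x, f x) • g - (∑ x, g x) • f, d, fun h0 => ?_, ?_, ?_, hν.le⟩
  · have hgg := congrArg (· ⬝ᵥ g) h0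
    simp only [sub_dotProduct, smul_dotProduct, hfg, zero_dotProduct, smul_eq_mul, mul_zero,
      sub_zero, mul_eq_zero, hsf, false_or] at hgg
    exact hg0 (dotProduct_self_eq_zero.mp hgg)
  · simp only [Pi.sub_apply, Pi.smul_apply, smul_eq_mul, sum_sub_distrib, ← mul_sum]
    ring
  · rw [mulVec_sub, mulVec_smul, mulVec_smul, hf, hg, hμ, hν, smul_sub, smul_comm (d : ℝ),
      smul_comm (d : ℝ)]

end Spectral

section AdjEigenvalue

variable {V : Type*} [Fintype V] {G : SimpleGraph V} {d : ℕ}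

/-- The vertex that indexes `λ_{k+1}` in the eigenvector basis of the adjacency matrix. -/
noncomputable def eigenIndex (V : Type*) [Fintype V] : Fin (Fintype.card V) ≃ V :=
  Fintype.equivOfCardEq (Fintype.card_fin _)

open Classical in
theorem eigenvalues_eigenIndex (k : Fin (Fintype.card V)) :
    (G.isHermitian_adjMatrix ℝ).eigenvalues (eigenIndex V k) = adjEigenvalue G (k + 1) := by
  rw [adjEigenvalue, dif_pos ⟨by lia, by lia⟩]
  simp [Matrix.IsHermitian.eigenvalues, eigenIndex]

open Classical in
theorem adjEigenvalue_anti {k l : ℕ} (hk : 1 ≤ k) (hkl : k ≤ l) (hl : l ≤ Fintype.card V) :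
    adjEigenvalue G l ≤ adjEigenvalue G k := by
  rw [adjEigenvalue, adjEigenvalue, dif_pos ⟨hk.trans hkl, hl⟩, dif_pos ⟨hk, hkl.trans hl⟩]
  exact (G.isHermitian_adjMatrix ℝ).eigenvalues₀_antitone (Nat.sub_le_sub_right hkl 1)

open Classical in
theorem eigenvectorBasis_ne_zero (j : V) :
    ⇑((G.isHermitian_adjMatrix ℝ).eigenvectorBasis j) ≠ 0 := fun h =>
  (G.isHermitian_adjMatrix ℝ).eigenvectorBasis.orthonormal.ne_zero j
    (by ext x; exact congrFun h x)

open Classical in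
theorem eigenvectorBasis_dotProduct {i j : V} (h : i ≠ j) :
    ⇑((G.isHermitian_adjMatrix ℝ).eigenvectorBasis i) ⬝ᵥ
      ⇑((G.isHermitian_adjMatrix ℝ).eigenvectorBasis j) = 0 := by
  have := (G.isHermitian_adjMatrix ℝ).eigenvectorBasis.orthonormal.2 h
  simpa [EuclideanSpace.inner_eq_star_dotProduct, dotProduct_comm] using this

open Classical in
theorem eq_zero_of_forall_eigenvectorBasis_dotProduct {g : V → ℝ}
    (h : ∀ j, ⇑((G.isHermitian_adjMatrix ℝ).eigenvectorBasis j) ⬝ᵥ g = 0) : g = 0 := by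
  have hzero : WithLp.toLp 2 g = (0 : EuclideanSpace ℝ V) := by
    refine InnerProductSpace.ext_inner_left_basis
      (G.isHermitian_adjMatrix ℝ).eigenvectorBasis.toBasis fun j => ?_
    simpa [EuclideanSpace.inner_eq_star_dotProduct, dotProduct_comm] using h j
  simpa using hzero

open Classical in
theorem exists_eigenvector_adjEigenvalue_two_le (hreg : G.IsRegularOfDegree d)
    (hcard : 2 ≤ Fintype.card V) :
    ∃ (f : V → ℝ) (μ : ℝ), f ≠ 0 ∧ ∑ x, f x = 0 ∧ G.adjMatrix ℝ *ᵥ f = μ • f ∧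
      adjEigenvalue G 2 ≤ μ := by
  have hij : eigenIndex V ⟨0, by lia⟩ ≠ eigenIndex V ⟨1, by lia⟩ := by simp
  rw [← eigenvalues_eigenIndex ⟨1, by lia⟩]
  refine exists_sum_eq_zero_eigenvector hreg (eigenvectorBasis_ne_zero _)
    (eigenvectorBasis_ne_zero _) (eigenvectorBasis_dotProduct hij)
    ((G.isHermitian_adjMatrix ℝ).mulVec_eigenvectorBasis _)
    ((G.isHermitian_adjMatrix ℝ).mulVec_eigenvectorBasis _) ?_
  rw [eigenvalues_eigenIndex, eigenvalues_eigenIndex]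
  exact adjEigenvalue_anti le_rfl one_le_two hcard

open Classical in
theorem adjEigenvalue_two_le (hreg : G.IsRegularOfDegree d) {θ : ℝ} (hθ : 0 ≤ θ)
    (h : ∀ (f : V → ℝ) (μ : ℝ), f ≠ 0 → ∑ x, f x = 0 → G.adjMatrix ℝ *ᵥ f = μ • f → μ ≤ θ) :
    adjEigenvalue G 2 ≤ θ := by
  by_cases hcard : 2 ≤ Fintype.card V
  · obtain ⟨f, μ, h0, hs, hf, hle⟩ := exists_eigenvector_adjEigenvalue_two_le hreg hcard
    exact hle.trans (h f μ h0 hs hf)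
  · rwa [adjEigenvalue, dif_neg (by lia)]

open Classical in
theorem adjEigenvalue_two_le_of_pow (hreg : G.IsRegularOfDegree d) {k : ℕ} (hk : 0 < k) {m δ : ℝ}
    (hδ1 : δ ≤ 1) (hm : ∀ y z, m ≤ (G.adjMatrix ℝ ^ k) y z)
    (hδ : δ * (d : ℝ) ^ k ≤ m * Fintype.card V) :
    adjEigenvalue G 2 ≤ (1 - δ / k) * d := by
  have hk1 : (1 : ℝ) ≤ k := by exact_mod_cast hk
  have hδk : δ / k ≤ 1 := by
    rw [div_le_one (by linarith)]
    linarith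
  have hnn : 0 ≤ (1 - δ / k) * d := mul_nonneg (by linarith) (Nat.cast_nonneg d)
  refine adjEigenvalue_two_le hreg hnn fun f μ h0 hs hf => ?_
  have hbernoulli : 1 - δ ≤ (1 - δ / k) ^ k := by
    have := one_add_mul_le_pow (a := -(δ / k)) (by linarith) k
    rwa [mul_neg, mul_div_cancel₀ _ (by linarith), ← sub_eq_add_neg, ← sub_eq_add_neg] at this
  have hpow : |μ| ^ k ≤ ((1 - δ / k) * d) ^ k :=
    calc |μ| ^ k ≤ (1 - δ) * (d : ℝ) ^ k := by
          linarith [abs_eigenvalue_pow_le_of_forall_le_pow hm (sum_adjMatrix hreg) h0 hs hf]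
      _ ≤ (1 - δ / k) ^ k * (d : ℝ) ^ k := by gcongr
      _ = _ := (mul_pow _ _ _).symm
  exact (le_abs_self μ).trans (le_of_pow_le_pow_left₀ hk.ne' hnn hpow)

open Classical in
theorem spectralGap_pos (hreg : G.IsRegularOfDegree d) (hd : 0 < d) (hc : G.Connected)
    (hb : ¬ G.IsBipartite) : 0 < spectralGap G d := by
  have hcard : 2 ≤ Fintype.card V := by
    obtain ⟨x⟩ := hc.nonempty
    have := G.degree_lt_card_verts x
    rw [hreg x] at this
    lia
  rw [spectralGap, sub_pos, div_lt_one (Nat.cast_pos.mpr hd), lambdaMax, max_lt_iff]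
  constructor
  · obtain ⟨f, μ, h0, hs, hf, hle⟩ := exists_eigenvector_adjEigenvalue_two_le hreg hcard
    exact hle.trans_lt (eigenvalue_lt_degree hreg hc h0 hs hf)
  · have hlast := eigenvalues_eigenIndex (G := G) ⟨Fintype.card V - 1, by lia⟩
    rw [Nat.sub_add_cancel (by lia)] at hlast
    rw [← hlast]
    exact neg_eigenvalue_lt_degree hreg hc hb (eigenvectorBasis_ne_zero _)
      ((G.isHermitian_adjMatrix ℝ).mulVec_eigenvectorBasis _)

open Classical in
theorem abs_eigenvalues_eigenIndex_le_lambdaMax {k : Fin (Fintype.card V)} (hk : 1 ≤ (k : ℕ)) :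
    |(G.isHermitian_adjMatrix ℝ).eigenvalues (eigenIndex V k)| ≤ lambdaMax G := by
  rw [eigenvalues_eigenIndex, abs_le', lambdaMax]
  exact ⟨le_max_of_le_left (adjEigenvalue_anti one_le_two (by lia) k.2),
    le_max_of_le_right (neg_le_neg (adjEigenvalue_anti (by lia) k.2 le_rfl))⟩

open Classical in
theorem exists_eigenvalues_eq_degree [Nonempty V] (hreg : G.IsRegularOfDegree d) :
    ∃ j, (G.isHermitian_adjMatrix ℝ).eigenvalues j = d := by
  have hsum : ∃ j, ∑ x, (G.isHermitian_adjMatrix ℝ).eigenvectorBasis j x ≠ 0 := by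
    by_contra! h
    refine one_ne_zero (eq_zero_of_forall_eigenvectorBasis_dotProduct (G := G) fun j => ?_)
    rw [dotProduct_one, h j]
  obtain ⟨j, hj⟩ := hsum
  have hmul := mul_sum_eq_zero hreg ((G.isHermitian_adjMatrix ℝ).mulVec_eigenvectorBasis j)
  exact ⟨j, sub_eq_zero.mp ((mul_eq_zero.mp hmul).resolve_right hj)⟩

open Classical in
theorem abs_eigenvalues_le_or_eq_degree (hreg : G.IsRegularOfDegree d) (hd : 0 < d)
    (hc : G.Connected) {γ : ℝ} (hγ : 0 < γ) (hle : γ ≤ spectralGap G d) (j : V) :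
    |(G.isHermitian_adjMatrix ℝ).eigenvalues j| ≤ (1 - γ) * d ∨
      (G.isHermitian_adjMatrix ℝ).eigenvalues j = d ∧
        ∀ x y, (G.isHermitian_adjMatrix ℝ).eigenvectorBasis j x =
          (G.isHermitian_adjMatrix ℝ).eigenvectorBasis j y := by
  have hd' : (0 : ℝ) < d := Nat.cast_pos.mpr hd
  have hmax : lambdaMax G ≤ (1 - γ) * d := by
    rw [spectralGap] at hle
    rw [← div_le_iff₀ hd']
    linarith
  obtain ⟨k, rfl⟩ := (eigenIndex V).surjective j
  rcases Nat.eq_zero_or_pos (k : ℕ) with hk | hk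
  · right
    have := hc.nonempty
    obtain ⟨i, hi⟩ := exists_eigenvalues_eq_degree hreg
    obtain ⟨l, rfl⟩ := (eigenIndex V).surjective i
    have hl : l = k := by
      by_contra hlk
      have := (abs_eigenvalues_eigenIndex_le_lambdaMax (G := G) (k := l) (by lia)).trans hmax
      rw [hi, abs_of_pos hd'] at this
      nlinarith
    rw [hl] at hi
    exact ⟨hi, eq_of_degree_le_eigenvalue hreg hc
      ((G.isHermitian_adjMatrix ℝ).mulVec_eigenvectorBasis _) hi.ge⟩
  · exact .inl ((abs_eigenvalues_eigenIndex_le_lambdaMax hk).trans hmax)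

end AdjEigenvalue

/-- The normalized spherical function of the `d`-regular tree: the eigenvalue of the operator
averaging over the sphere of radius `r`, on an eigenvector with normalized adjacency eigenvalue `x`.
The parameter is `θ = 1 / d`. -/
noncomputable def sphericalValue (θ x : ℝ) : ℕ → ℝ
  | 0 => 1
  | 1 => x
  | r + 2 => (x * sphericalValue θ x (r + 1) - θ * sphericalValue θ x r) / (1 - θ)

/-- The quadratic form `b² + a² - 2xab` at two consecutive values `a`, `b` of the spherical
function: an energy that decreases along the recurrence. -/
noncomputable def sphericalEnergy (θ x : ℝ) (r : ℕ) : ℝ :=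
  sphericalValue θ x (r + 1) ^ 2 + sphericalValue θ x r ^ 2 -
    2 * x * sphericalValue θ x r * sphericalValue θ x (r + 1)

section Spherical

variable {θ x γ : ℝ}

theorem sphericalValue_recurrence (hθ : θ ≤ 1 / 3) (r : ℕ) :
    (1 - θ) * sphericalValue θ x (r + 2) =
      x * sphericalValue θ x (r + 1) - θ * sphericalValue θ x r := by
  rw [sphericalValue, mul_div_cancel₀]
  linarith

theorem sphericalValue_one (hθ : θ ≤ 1 / 3) (r : ℕ) : sphericalValue θ 1 r = 1 := by
  induction r using Nat.twoStepInduction with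
  | zero => rfl
  | one => rfl
  | more r h0 h1 =>
    have h := sphericalValue_recurrence (x := 1) hθ r
    rw [h0, h1, mul_one, mul_one] at h
    exact mul_left_cancel₀ (by linarith : 1 - θ ≠ 0) (by rw [h, mul_one])

theorem sphericalEnergy_antitone (hθ : θ ≤ 1 / 3) : Antitone (sphericalEnergy θ x) := by
  refine antitone_nat_of_succ_le fun r => ?_
  have hdrop : sphericalEnergy θ x r - sphericalEnergy θ x (r + 1) =
      (1 - 2 * θ) * (sphericalValue θ x (r + 2) - sphericalValue θ x r) ^ 2 := by
    simp only [sphericalEnergy]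
    linear_combination -2 * (sphericalValue θ x (r + 2) - sphericalValue θ x r) *
      sphericalValue_recurrence (x := x) hθ r
  have : 0 ≤ (1 - 2 * θ) * (sphericalValue θ x (r + 2) - sphericalValue θ x r) ^ 2 :=
    mul_nonneg (by linarith) (sq_nonneg _)
  linarith

theorem sphericalEnergy_one_le (hθ0 : 0 ≤ θ) (hθ : θ ≤ 1 / 3) :
    sphericalEnergy θ x 1 ≤ (1 - x ^ 2) - 3 / 4 * (1 - x ^ 2) ^ 2 := by
  have h : (1 - θ) * (sphericalValue θ x 2 - 1) = x ^ 2 - 1 := by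
    have : (1 - θ) * sphericalValue θ x 2 = x * x - θ * 1 := sphericalValue_recurrence hθ 0
    linear_combination this
  have henergy : sphericalEnergy θ x 1 =
      (1 - x ^ 2) - (1 - 2 * θ) * (sphericalValue θ x 2 - 1) ^ 2 := by
    have : sphericalEnergy θ x 1 =
      sphericalValue θ x 2 ^ 2 + x ^ 2 - 2 * x * x * sphericalValue θ x 2 := rfl
    rw [this]
    linear_combination 2 * (sphericalValue θ x 2 - 1) * h
  have hsq : (1 - x ^ 2) ^ 2 = (1 - θ) ^ 2 * (sphericalValue θ x 2 - 1) ^ 2 := by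
    rw [← mul_pow, h]
    ring
  have hcoeff : 3 / 4 * (1 - θ) ^ 2 ≤ 1 - 2 * θ := by nlinarith
  have := mul_le_mul_of_nonneg_right hcoeff (sq_nonneg (sphericalValue θ x 2 - 1))
  rw [henergy, hsq]
  linarith

theorem sphericalValue_succ_sq_le (hθ0 : 0 ≤ θ) (hθ : θ ≤ 1 / 3) (hx : x ^ 2 < 1) (r : ℕ) :
    sphericalValue θ x (r + 1) ^ 2 ≤ 1 - 3 / 4 * (1 - x ^ 2) := by
  have henergy : sphericalEnergy θ x (r + 1) ≤ (1 - x ^ 2) - 3 / 4 * (1 - x ^ 2) ^ 2 :=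
    (sphericalEnergy_antitone hθ (by lia)).trans (sphericalEnergy_one_le hθ0 hθ)
  have hsquare : sphericalEnergy θ x (r + 1) = (1 - x ^ 2) * sphericalValue θ x (r + 1) ^ 2 +
      (sphericalValue θ x (r + 2) - x * sphericalValue θ x (r + 1)) ^ 2 := by
    rw [sphericalEnergy]
    ring
  refine le_of_mul_le_mul_left ?_ (sub_pos.mpr hx)
  linarith [sq_nonneg (sphericalValue θ x (r + 2) - x * sphericalValue θ x (r + 1))]

theorem abs_sphericalValue_succ_le (hθ0 : 0 ≤ θ) (hθ : θ ≤ 1 / 3) (hγ : 0 < γ)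
    (hx : |x| ≤ 1 - γ) (r : ℕ) : |sphericalValue θ x (r + 1)| ≤ 1 - 3 / 8 * γ := by
  have hγ1 : γ ≤ 1 := by linarith [abs_nonneg x]
  have hx2 : x ^ 2 ≤ (1 - γ) ^ 2 := sq_le_sq' (abs_le.mp hx).1 (abs_le.mp hx).2
  have h := sphericalValue_succ_sq_le hθ0 hθ (x := x) (by nlinarith) r
  exact abs_le_of_sq_le_sq (by nlinarith) (by linarith)

theorem abs_sphericalValue_le_one (hθ0 : 0 ≤ θ) (hθ : θ ≤ 1 / 3) (hγ : 0 < γ)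
    (hx : |x| ≤ 1 - γ) (r : ℕ) : |sphericalValue θ x r| ≤ 1 := by
  cases r with
  | zero => simp [sphericalValue]
  | succ r => linarith [abs_sphericalValue_succ_le hθ0 hθ hγ hx r]

end Spherical

/-- The rearrangements of a tuple `s`: the tuples with the same multiset of entries. -/
def arrangements {m : ℕ} (s : Fin m → ℕ) : Finset (Fin m → ℕ) :=
  univ.image fun π : Equiv.Perm (Fin m) => s ∘ π

section Arrangements

variable {m : ℕ} {s u : Fin m → ℕ}

theorem mem_arrangements_iff_exists_perm :
    u ∈ arrangements s ↔ ∃ π : Equiv.Perm (Fin m), s ∘ π = u := by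
  simp [arrangements]

theorem mem_arrangements_iff : u ∈ arrangements s ↔ univ.val.map u = univ.val.map s := by
  rw [mem_arrangements_iff_exists_perm]
  constructor
  · rintro ⟨π, rfl⟩
    rw [← Multiset.map_map, Multiset.map_univ_val_equiv π]
  · intro h
    have hperm : (List.ofFn u).Perm (List.ofFn s) := by
      rwa [Fin.univ_val_map, Fin.univ_val_map, Multiset.coe_eq_coe] at h
    have hsort : u ∘ Tuple.sort u = s ∘ Tuple.sort s := by
      refine List.ofFn_injective (List.Perm.eq_of_sortedLE ?_ ?_ ?_)
      · exact (Tuple.monotone_sort u).sortedLE_ofFn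
      · exact (Tuple.monotone_sort s).sortedLE_ofFn
      · exact ((Equiv.Perm.ofFn_comp_perm _ u).trans hperm).trans
          (Equiv.Perm.ofFn_comp_perm _ s).symm
    refine ⟨Tuple.sort s * (Tuple.sort u)⁻¹, ?_⟩
    rw [Equiv.Perm.coe_mul, ← Function.comp_assoc, ← hsort, Function.comp_assoc,
      ← Equiv.Perm.coe_mul, mul_inv_cancel, Equiv.Perm.coe_one, Function.comp_id]

theorem self_mem_arrangements (s : Fin m → ℕ) : s ∈ arrangements s :=
  mem_arrangements_iff.mpr rfl

theorem card_arrangements_pos (s : Fin m → ℕ) : 0 < #(arrangements s) :=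
  card_pos.mpr ⟨s, self_mem_arrangements s⟩

theorem comp_perm_mem_arrangements (hu : u ∈ arrangements s) (π : Equiv.Perm (Fin m)) :
    u ∘ π ∈ arrangements s := by
  obtain ⟨π', rfl⟩ := mem_arrangements_iff_exists_perm.mp hu
  exact mem_arrangements_iff_exists_perm.mpr ⟨π' * π, rfl⟩

theorem sum_arrangements_comp_perm {M : Type*} [AddCommMonoid M] (π : Equiv.Perm (Fin m))
    (F : (Fin m → ℕ) → M) : ∑ u ∈ arrangements s, F (u ∘ π) = ∑ u ∈ arrangements s, F u := by
  refine sum_nbij' (· ∘ π) (· ∘ π.symm) (fun u hu => comp_perm_mem_arrangements hu π)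
    (fun u hu => comp_perm_mem_arrangements hu π.symm) ?_ ?_ fun u _ => rfl
  · intro u _
    simp [Function.comp_assoc]
  · intro u _
    simp [Function.comp_assoc]

@[to_additive]
theorem prod_of_mem_arrangements {M : Type*} [CommMonoid M] (g : ℕ → M)
    (hu : u ∈ arrangements s) : ∏ i, g (u i) = ∏ i, g (s i) := by
  obtain ⟨π, rfl⟩ := mem_arrangements_iff_exists_perm.mp hu
  exact Equiv.prod_comp π fun i => g (s i)

theorem forall_of_mem_arrangements {P : ℕ → Prop} (h : ∀ i, P (s i)) (hu : u ∈ arrangements s)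
    (i : Fin m) : P (u i) := by
  obtain ⟨π, rfl⟩ := mem_arrangements_iff_exists_perm.mp hu
  exact h (π i)

theorem sum_arrangements_fiberwise {ι M : Type*} [Fintype ι] [AddCommMonoid M]
    (f : ι → Fin m → ℕ) (F : ι → M) :
    ∑ y with f y ∈ arrangements s, F y = ∑ u ∈ arrangements s, ∑ y with f y = u, F y := by
  rw [← sum_fiberwise_of_maps_to (g := f) (t := arrangements s) (by simp)]
  refine sum_congr rfl fun u hu => ?_
  rw [filter_filter]
  exact sum_congr (filter_congr fun y _ => and_iff_right_of_imp fun h => h ▸ hu) fun _ _ => rfl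

end Arrangements

/-- The polygraph `G_S` whose multiset `S` consists of the entries of a tuple `s`. -/
abbrev tuplePolygraph {V : Type*} (G : SimpleGraph V) {m : ℕ} (s : Fin m → ℕ) :
    SimpleGraph (Fin m → V) :=
  polygraph G (univ.val.map s)

/-- The degree of the polygraph of a `d`-regular graph of large girth. -/
def polygraphDegree {m : ℕ} (s : Fin m → ℕ) (d : ℕ) : ℕ :=
  #(arrangements s) * ∏ i, sphereCount d (s i)

/-- The degree of the links of the polygraph of a `d`-regular graph of large girth. -/
def polygraphLinkDegree {m : ℕ} (s : Fin m → ℕ) (d : ℕ) : ℕ :=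
  ∑ τ ∈ arrangements s, ∑ υ ∈ arrangements s, ∏ i, triangleCount d (s i) (τ i) (υ i)

/-- The square root of the branching number `d - 1` of the `d`-regular tree. -/
noncomputable def rootGrowth (d : ℕ) : ℝ :=
  √((d - 1 : ℕ) : ℝ)

section DegreeBounds

variable {d : ℕ}

theorem rootGrowth_pos (hd : 3 ≤ d) : 0 < rootGrowth d :=
  Real.sqrt_pos.mpr (Nat.cast_pos.mpr (by lia))

theorem rootGrowth_pow_two_mul (d n : ℕ) : rootGrowth d ^ (2 * n) = ((d - 1) ^ n : ℕ) := by
  rw [pow_mul, rootGrowth, Real.sq_sqrt (Nat.cast_nonneg _), Nat.cast_pow]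

theorem tripodCount_succ (d α β κ : ℕ) :
    tripodCount d α β (κ + 1) = (d - 1) ^ κ * childCount d α β 0 := by
  simp [tripodCount, prod_range_succ', childCount]

theorem pow_le_two_mul_tripodCount (hd : 3 ≤ d) (α β κ : ℕ) :
    (d - 1) ^ κ ≤ 2 * tripodCount d α β κ := by
  cases κ with
  | zero => simp [tripodCount]
  | succ κ =>
    rw [tripodCount_succ, pow_succ, mul_left_comm]
    refine Nat.mul_le_mul_left _ ?_
    simp only [childCount]
    split_ifs <;> lia

theorem tripodCount_le_two_mul_pow (hd : 3 ≤ d) (α β κ : ℕ) :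
    tripodCount d α β κ ≤ 2 * (d - 1) ^ κ := by
  cases κ with
  | zero => simp [tripodCount]
  | succ κ =>
    rw [tripodCount_succ, pow_succ, mul_left_comm]
    refine Nat.mul_le_mul_left _ ?_
    simp only [childCount]
    split_ifs <;> lia

/-- `i`, `j`, `k` are the mutual distances of three vertices of a tree. -/
structure IsTreeTriangle (i j k : ℕ) : Prop where
  even : Even (i + j + k)
  le₁ : i ≤ j + k
  le₂ : j ≤ i + k
  le₃ : k ≤ i + j

theorem pow_le_triangleCount (hd : 3 ≤ d) {i j k : ℕ} (h : IsTreeTriangle i j k) :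
    rootGrowth d ^ (j + k) ≤ 2 * (rootGrowth d ^ i * triangleCount d i j k) := by
  have hpos := rootGrowth_pos hd
  have hdepth : j + k = i + 2 * ((j + k - i) / 2) := by grind [h.even, h.le₁]
  rw [triangleCount, if_pos ⟨h.le₁, h.le₂, h.le₃⟩, hdepth, pow_add, rootGrowth_pow_two_mul,
    mul_left_comm]
  have := pow_le_two_mul_tripodCount hd ((i + j - k) / 2) ((i + k - j) / 2) ((j + k - i) / 2)
  rw [← hdepth]
  gcongr
  exact_mod_cast this

theorem triangleCount_le (hd : 3 ≤ d) {i j k : ℕ} (heven : Even (i + j + k)) :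
    rootGrowth d ^ i * triangleCount d i j k ≤ 2 * rootGrowth d ^ (j + k) := by
  have hpos := rootGrowth_pos hd
  rw [triangleCount]
  split_ifs with h
  · have hdepth : j + k = i + 2 * ((j + k - i) / 2) := by grind
    rw [hdepth, pow_add, rootGrowth_pow_two_mul, mul_left_comm, ← hdepth]
    gcongr
    exact_mod_cast tripodCount_le_two_mul_pow hd _ _ _
  · rw [Nat.cast_zero, mul_zero]
    positivity

variable {m : ℕ} {s : Fin m → ℕ}

theorem prod_pow_of_mem_arrangements {u : Fin m → ℕ} (hu : u ∈ arrangements s) (h : ℝ) :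
    ∏ i, h ^ u i = h ^ ∑ i, s i := by
  rw [prod_of_mem_arrangements (h ^ ·) hu, prod_pow_eq_pow_sum]

theorem prod_triangleCount_le (hd : 3 ≤ d) (heven : ∀ i, Even (s i)) {τ υ : Fin m → ℕ}
    (hτ : τ ∈ arrangements s) (hυ : υ ∈ arrangements s) :
    ((∏ i, triangleCount d (s i) (τ i) (υ i) : ℕ) : ℝ) ≤ 2 ^ m * rootGrowth d ^ ∑ i, s i := by
  have hpos := rootGrowth_pos hd
  refine le_of_mul_le_mul_left ?_ (pow_pos hpos (∑ i, s i))
  calc rootGrowth d ^ (∑ i, s i) * ((∏ i, triangleCount d (s i) (τ i) (υ i) : ℕ) : ℝ)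
      = ∏ i, rootGrowth d ^ s i * triangleCount d (s i) (τ i) (υ i) := by
        rw [prod_mul_distrib, prod_pow_eq_pow_sum, Nat.cast_prod]
    _ ≤ ∏ i, 2 * (rootGrowth d ^ τ i * rootGrowth d ^ υ i) := by
        refine prod_le_prod (fun i _ => by positivity) fun i _ => ?_
        rw [← pow_add]
        exact triangleCount_le hd (((heven i).add
          (forall_of_mem_arrangements heven hτ i)).add (forall_of_mem_arrangements heven hυ i))
    _ = _ := by
        rw [prod_mul_distrib, prod_mul_distrib, prod_pow_of_mem_arrangements hτ,
          prod_pow_of_mem_arrangements hυ, prod_const, card_univ, Fintype.card_fin]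
        ring

theorem polygraphLinkDegree_le (hd : 3 ≤ d) (heven : ∀ i, Even (s i)) :
    (polygraphLinkDegree s d : ℝ) ≤
      #(arrangements s) ^ 2 * 2 ^ m * rootGrowth d ^ ∑ i, s i := by
  rw [polygraphLinkDegree, Nat.cast_sum]
  simp_rw [Nat.cast_sum]
  calc _ ≤ ∑ _τ ∈ arrangements s, ∑ _υ ∈ arrangements s, 2 ^ m * rootGrowth d ^ ∑ i, s i :=
        sum_le_sum fun τ hτ => sum_le_sum fun υ hυ => prod_triangleCount_le hd heven hτ hυ
    _ = _ := by
        simp only [sum_const, nsmul_eq_mul]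
        ring

theorem pow_le_polygraphDegree (s : Fin m → ℕ) (d : ℕ) :
    rootGrowth d ^ (2 * ∑ i, s i) ≤ polygraphDegree s d := by
  rw [rootGrowth_pow_two_mul, Nat.cast_le]
  calc (d - 1) ^ (∑ i, s i) = ∏ i, (d - 1) ^ s i := (prod_pow_eq_pow_sum _ _ _).symm
    _ ≤ ∏ i, sphereCount d (s i) := prod_le_prod' fun i _ => pow_le_sphereCount d (s i)
    _ ≤ _ := Nat.le_mul_of_pos_left _ (card_arrangements_pos s)

theorem polygraphDegree_pos (s : Fin m → ℕ) (hd : 3 ≤ d) : 0 < polygraphDegree s d := by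
  have := (pow_pos (rootGrowth_pos hd) _).trans_le (pow_le_polygraphDegree s d)
  exact_mod_cast this

theorem triangleCount_pos (hd : 3 ≤ d) {i j k : ℕ} (h : IsTreeTriangle i j k) :
    0 < triangleCount d i j k := by
  have hpos := rootGrowth_pos hd
  have := (pow_pos hpos _).trans_le (pow_le_triangleCount hd h)
  rw [← mul_assoc, mul_pos_iff_of_pos_left (by positivity)] at this
  exact_mod_cast this

theorem polygraphLinkDegree_pos (hd : 3 ≤ d) (heven : ∀ i, Even (s i)) :
    0 < polygraphLinkDegree s d := by
  have hmem := self_mem_arrangements s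
  refine sum_pos' (fun _ _ => Nat.zero_le _) ⟨s, hmem, ?_⟩
  refine sum_pos' (fun _ _ => Nat.zero_le _) ⟨s, hmem, ?_⟩
  refine prod_pos fun i _ => triangleCount_pos hd ⟨?_, ?_, ?_, ?_⟩
  · exact ((heven i).add (heven i)).add (heven i)
  all_goals lia

end DegreeBounds

section Polygraph

theorem card_filter_forall {ι W : Type*} [Fintype ι] [DecidableEq ι] [Fintype W]
    {P : ι → W → Prop} [∀ i, DecidablePred (P i)]
    [DecidablePred fun z : ι → W => ∀ i, P i (z i)] :
    #{z : ι → W | ∀ i, P i (z i)} = ∏ i, #{v | P i v} := by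
  rw [← Fintype.card_piFinset]
  congr 1
  ext z
  simp

open Classical in
theorem card_link_neighbors {W : Type*} [Fintype W] {H : SimpleGraph W} {x : W}
    (y : H.neighborSet x) : #{w | (link H x).Adj y w} = #{z | H.Adj x z ∧ H.Adj y.1 z} := by
  refine card_bij (fun w _ => w.1) ?_ (fun _ _ _ _ h => Subtype.ext h) ?_
  · intro w hw
    rw [mem_filter_univ] at hw ⊢
    exact ⟨w.2, hw⟩
  · intro z hz
    rw [mem_filter_univ] at hz
    exact ⟨⟨z, hz.1⟩, by rw [mem_filter_univ]; exact hz.2, rfl⟩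

variable {V : Type*} {G : SimpleGraph V} {m : ℕ} {s : Fin m → ℕ}

theorem tuplePolygraph_adj_iff (hs : s ≠ 0) {x y : Fin m → V} :
    (tuplePolygraph G s).Adj x y ↔ (fun i => G.dist (x i) (y i)) ∈ arrangements s := by
  rw [mem_arrangements_iff]
  refine ⟨And.right, fun h => ⟨?_, h⟩⟩
  rintro rfl
  simp only [SimpleGraph.dist_self] at h
  refine hs (funext fun i => ?_)
  have hmem := Multiset.mem_map_of_mem s (mem_univ_val i)
  rw [← h] at hmem
  obtain ⟨-, -, hi⟩ := Multiset.mem_map.mp hmem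
  exact hi.symm

variable [Fintype V] [DecidableRel G.Adj] {g d : ℕ}

open Classical in
theorem card_polygraph_neighbors (hc : G.Connected) (hg : (g : ℕ∞) < G.egirth)
    (hreg : G.IsRegularOfDegree d) (hs : s ≠ 0) (hsg : ∀ i, 2 * s i ≤ g) (x : Fin m → V) :
    #{y | (tuplePolygraph G s).Adj x y} = polygraphDegree s d := by
  simp_rw [tuplePolygraph_adj_iff hs]
  rw [card_eq_sum_ones, sum_arrangements_fiberwise, polygraphDegree, ← smul_eq_mul, ← sum_const]
  refine sum_congr rfl fun u hu => ?_
  simp_rw [← card_eq_sum_ones, funext_iff]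
  rw [card_filter_forall (P := fun i v => G.dist (x i) v = u i),
    ← prod_of_mem_arrangements (sphereCount d) hu]
  exact prod_congr rfl fun i _ =>
    card_sphere hc hg hreg (forall_of_mem_arrangements (P := fun k => 2 * k ≤ g) hsg hu i) _

open Classical in
theorem card_polygraph_common_neighbors_eq_sum (hc : G.Connected) (hg : (g : ℕ∞) < G.egirth)
    (hreg : G.IsRegularOfDegree d) (hs : s ≠ 0) (heven : ∀ i, Even (s i))
    (hsg : ∀ i, 3 * s i ≤ g) {x y : Fin m → V} (hxy : (tuplePolygraph G s).Adj x y) :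
    #{z | (tuplePolygraph G s).Adj x z ∧ (tuplePolygraph G s).Adj y z} =
      ∑ τ ∈ arrangements s, ∑ υ ∈ arrangements s,
        ∏ i, triangleCount d (G.dist (x i) (y i)) (τ i) (υ i) := by
  have hside {u : Fin m → ℕ} (hu : u ∈ arrangements s) (i : Fin m) :
      Even (u i) ∧ 3 * u i ≤ g :=
    forall_of_mem_arrangements (P := fun k => Even k ∧ 3 * k ≤ g) (fun i => ⟨heven i, hsg i⟩) hu i
  have hside' := hside ((tuplePolygraph_adj_iff hs).mp hxy)
  simp_rw [tuplePolygraph_adj_iff hs, ← filter_filter]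
  rw [card_eq_sum_ones, sum_filter, sum_arrangements_fiberwise]
  refine sum_congr rfl fun τ hτ => ?_
  rw [← sum_filter, filter_filter]
  simp_rw [and_comm (b := _ ∈ arrangements s)]
  rw [← filter_filter, sum_filter, sum_arrangements_fiberwise]
  refine sum_congr rfl fun υ hυ => ?_
  rw [← sum_filter, filter_filter, ← card_eq_sum_ones]
  simp_rw [funext_iff, ← forall_and, and_comm (a := G.dist (y _) _ = _)]
  rw [card_filter_forall (P := fun i v => G.dist (x i) v = τ i ∧ G.dist (y i) v = υ i)]
  refine prod_congr rfl fun i _ => card_triangle hc hg hreg ?_ ?_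
  · exact ((hside' i).1.add (hside hτ i).1).add (hside hυ i).1
  · linarith [(hside' i).2, (hside hτ i).2, (hside hυ i).2]

open Classical in
theorem card_polygraph_common_neighbors (hc : G.Connected) (hg : (g : ℕ∞) < G.egirth)
    (hreg : G.IsRegularOfDegree d) (hs : s ≠ 0) (heven : ∀ i, Even (s i))
    (hsg : ∀ i, 3 * s i ≤ g) {x y : Fin m → V} (hxy : (tuplePolygraph G s).Adj x y) :
    #{z | (tuplePolygraph G s).Adj x z ∧ (tuplePolygraph G s).Adj y z} =
      polygraphLinkDegree s d := by
  obtain ⟨π, hπ⟩ := mem_arrangements_iff_exists_perm.mp ((tuplePolygraph_adj_iff hs).mp hxy)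
  rw [card_polygraph_common_neighbors_eq_sum hc hg hreg hs heven hsg hxy, polygraphLinkDegree,
    ← sum_arrangements_comp_perm π]
  refine sum_congr rfl fun τ _ => ?_
  rw [← sum_arrangements_comp_perm π]
  refine sum_congr rfl fun υ _ => ?_
  rw [← Equiv.prod_comp π fun i => triangleCount d (s i) (τ i) (υ i)]
  exact prod_congr rfl fun i _ => by rw [← congrFun hπ i]; rfl

open Classical in
theorem polygraph_isRegularOfDegree (hc : G.Connected) (hg : (g : ℕ∞) < G.egirth)
    (hreg : G.IsRegularOfDegree d) (hs : s ≠ 0) (hsg : ∀ i, 2 * s i ≤ g) :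
    (tuplePolygraph G s).IsRegularOfDegree (polygraphDegree s d) := fun x => by
  rw [← SimpleGraph.card_neighborFinset_eq_degree, SimpleGraph.neighborFinset_eq_filter,
    card_polygraph_neighbors hc hg hreg hs hsg]

open Classical in
theorem link_isRegularOfDegree (hc : G.Connected) (hg : (g : ℕ∞) < G.egirth)
    (hreg : G.IsRegularOfDegree d) (hs : s ≠ 0) (heven : ∀ i, Even (s i))
    (hsg : ∀ i, 3 * s i ≤ g) (x : Fin m → V) :
    (link (tuplePolygraph G s) x).IsRegularOfDegree (polygraphLinkDegree s d) := fun y => by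
  rw [← SimpleGraph.card_neighborFinset_eq_degree, SimpleGraph.neighborFinset_eq_filter,
    ← card_polygraph_common_neighbors hc hg hreg hs heven hsg y.2, ← card_link_neighbors]

theorem polygraphLinkDegree_lt (hc : G.Connected) (hg : (g : ℕ∞) < G.egirth)
    (hreg : G.IsRegularOfDegree d) (hd : 3 ≤ d) (hs : s ≠ 0) (heven : ∀ i, Even (s i))
    (hsg : ∀ i, 3 * s i ≤ g) : polygraphLinkDegree s d < polygraphDegree s d := by
  classical
  obtain ⟨v⟩ := hc.nonempty
  have hN := card_polygraph_neighbors hc hg hreg hs (fun i => by linarith [hsg i]) fun _ => v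
  obtain ⟨y, hy⟩ := card_pos.mp (hN.symm ▸ polygraphDegree_pos s hd)
  rw [← hN, ← card_polygraph_common_neighbors hc hg hreg hs heven hsg (mem_filter.mp hy).2]
  refine card_lt_card ((ssubset_iff_of_subset fun z hz => ?_).mpr ⟨y, hy, ?_⟩)
  · rw [mem_filter_univ] at hz ⊢
    exact hz.1
  · simp

theorem polygraph_isABRegular (hc : G.Connected) (hg : (g : ℕ∞) < G.egirth)
    (hreg : G.IsRegularOfDegree d) (hd : 3 ≤ d) (hs : s ≠ 0) (heven : ∀ i, Even (s i))
    (hsg : ∀ i, 3 * s i ≤ g) :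
    IsABRegular (tuplePolygraph G s) (polygraphDegree s d) (polygraphLinkDegree s d) := by
  refine ⟨polygraphLinkDegree_lt hc hg hreg hd hs heven hsg, ?_, fun x => ?_⟩
  · convert polygraph_isRegularOfDegree hc hg hreg hs fun i => by linarith [hsg i]
  · convert link_isRegularOfDegree hc hg hreg hs heven hsg x

end Polygraph

section SphereSums

variable {V : Type*} [Fintype V] {G : SimpleGraph V} [DecidableRel G.Adj] {g d : ℕ}

theorem card_neighbors_on_sphere (hc : G.Connected) (hg : (g : ℕ∞) < G.egirth)
    (hreg : G.IsRegularOfDegree d) {r : ℕ} (hr : 2 * (r + 2) ≤ g) (x z : V) :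
    #{w ∈ G.neighborFinset z | G.dist x w = r + 1} =
      if G.dist x z = r + 2 then 1 else if G.dist x z = r then childCount d 0 0 r else 0 := by
  split_ifs with h h'
  · have hparents := card_parents hc hg (x := x) (w := z) (by lia)
    rw [h, if_neg (by lia)] at hparents
    simpa using hparents
  · simpa using card_children hc hg hreg (x := x) (y := x) (w := z) (α := 0) (β := 0) (κ := r)
      (by simp) (by simpa using h') (by simpa using h') (by lia)
  · rw [card_eq_zero, filter_eq_empty_iff]
    intro w hw hxw
    rw [SimpleGraph.mem_neighborFinset] at hw
    have hdiff := hw.diff_dist_adj (u := x)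
    have hne := dist_ne_of_adj hc hg (x := x) (by lia) hw.symm
    lia

theorem sum_sphere_sum_neighbors (hc : G.Connected) (hg : (g : ℕ∞) < G.egirth)
    (hreg : G.IsRegularOfDegree d) {r : ℕ} (hr : 2 * (r + 2) ≤ g) (x : V) (f : V → ℝ) :
    ∑ w with G.dist x w = r + 1, ∑ z ∈ G.neighborFinset w, f z =
      ∑ z with G.dist x z = r + 2, f z + childCount d 0 0 r * ∑ z with G.dist x z = r, f z := by
  rw [sum_comm' (t' := univ) (s' := fun z => {w ∈ G.neighborFinset z | G.dist x w = r + 1})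
    (by intro w z; simp [G.adj_comm, and_comm]), mul_sum, sum_filter, sum_filter,
    ← sum_add_distrib]
  refine sum_congr rfl fun z _ => ?_
  rw [sum_const, card_neighbors_on_sphere hc hg hreg hr]
  split_ifs with h h' <;> first | lia | simp

theorem sum_sphere_eigenvector (hc : G.Connected) (hg : (g : ℕ∞) < G.egirth)
    (hreg : G.IsRegularOfDegree d) (hd : 3 ≤ d) {f : V → ℝ} {μ : ℝ}
    (hf : G.adjMatrix ℝ *ᵥ f = μ • f) (x : V) {r : ℕ} (hr : 2 * r ≤ g) :
    ∑ y with G.dist x y = r, f y =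
      sphereCount d r * sphericalValue (d : ℝ)⁻¹ (μ / d) r * f x := by
  have hd0 : (d : ℝ) ≠ 0 := by positivity
  have hfx (w : V) : ∑ z ∈ G.neighborFinset w, f z = μ * f w := by
    simpa using congrFun hf w
  induction r using Nat.twoStepInduction with
  | zero =>
    have hsphere : ({y | G.dist x y = 0} : Finset V) = {x} := by
      ext y
      simp [hc.dist_eq_zero_iff, eq_comm]
    rw [hsphere, sum_singleton, sphereCount_zero, sphericalValue, Nat.cast_one, one_mul, one_mul]
  | one =>
    rw [sphereCount_succ, pow_zero, mul_one, sphericalValue, mul_div_cancel₀ _ hd0, ← hfx]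
    exact sum_congr (by ext; simp) fun _ _ => rfl
  | more r h0 h1 =>
    have hsum := sum_sphere_sum_neighbors hc hg hreg hr x f
    simp_rw [hfx] at hsum
    rw [← mul_sum, h0 (by lia), h1 (by lia)] at hsum
    have hθ : (d : ℝ)⁻¹ ≤ 1 / 3 := by
      rw [one_div]
      gcongr
      exact_mod_cast hd
    have hsv := sphericalValue_recurrence (x := μ / d) hθ r
    have hchild : (sphereCount d r : ℝ) * childCount d 0 0 r = sphereCount d (r + 1) := by
      rw [sphereCount, sphereCount, tripodCount, tripodCount, prod_range_succ, Nat.cast_mul]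
    have hgrow : (sphereCount d (r + 2) : ℝ) = sphereCount d (r + 1) * (d - 1) := by
      rw [sphereCount_succ, sphereCount_succ, pow_succ]
      push_cast [Nat.cast_sub (by lia : 1 ≤ d)]
      ring
    have hsv' : (d - 1) * sphericalValue (d : ℝ)⁻¹ (μ / d) (r + 2) =
        μ * sphericalValue (d : ℝ)⁻¹ (μ / d) (r + 1) - sphericalValue (d : ℝ)⁻¹ (μ / d) r := by
      linear_combination d * hsv + (sphericalValue (d : ℝ)⁻¹ (μ / d) (r + 2) -
        sphericalValue (d : ℝ)⁻¹ (μ / d) r) * mul_inv_cancel₀ hd0 +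
        sphericalValue (d : ℝ)⁻¹ (μ / d) (r + 1) * mul_div_cancel₀ μ hd0
    rw [hgrow]
    linear_combination (-1 : ℝ) * hsum -
      sphericalValue (d : ℝ)⁻¹ (μ / d) r * f x * hchild - sphereCount d (r + 1) * f x * hsv'

end SphereSums

/-- The matrix of the steps of length `s.1` that end at distance `s.2` from `o`. -/
noncomputable def stepMatrix {V : Type*} (G : SimpleGraph V) (o : V) (s : ℕ × ℕ) : Matrix V V ℝ :=
  Matrix.of fun y w => if G.dist o w = s.2 ∧ G.dist y w = s.1 then 1 else 0

/-- The matrix counting the walks whose steps have the lengths, and end at the distances from `o`,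
that are listed in `L`. -/
noncomputable def walkMatrix {V : Type*} [Fintype V] [DecidableEq V] (G : SimpleGraph V) (o : V)
    (L : List (ℕ × ℕ)) : Matrix V V ℝ :=
  (L.map (stepMatrix G o)).prod

/-- The walks counted by `walkMatrix G o L` spread from the sphere of radius `s` over that of radius
`t`: between any two vertices of these spheres, the number of walks is at least the one predicted by
the growth of the `d`-regular tree, up to a factor two for each step. -/
def IsSpreading {V : Type*} [Fintype V] [DecidableEq V] (G : SimpleGraph V) (d : ℕ) (o : V)
    (L : List (ℕ × ℕ)) (s t : ℕ) : Prop :=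
  ∀ y z, G.dist o y = s → G.dist o z = t →
    rootGrowth d ^ (L.map Prod.fst).sum ≤
      2 ^ L.length * rootGrowth d ^ (s + t) * walkMatrix G o L y z

section Spreading

theorem pow_add_le_of_mul_le {h n A : ℝ} (hh : 0 < h) {k s s' t u U : ℕ}
    (hlow : h ^ (s + u) ≤ 2 * (h ^ s' * n)) (hn : n * h ^ U ≤ 2 ^ k * h ^ (s + t) * A) :
    h ^ (u + U) ≤ 2 ^ (k + 1) * h ^ (s' + t) * A := by
  refine le_of_mul_le_mul_left ?_ (pow_pos hh s)
  calc h ^ s * h ^ (u + U) = h ^ (s + u) * h ^ U := by ring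
    _ ≤ 2 * (h ^ s' * n) * h ^ U := by gcongr
    _ = 2 * h ^ s' * (n * h ^ U) := by ring
    _ ≤ 2 * h ^ s' * (2 ^ k * h ^ (s + t) * A) := by gcongr
    _ = h ^ s * (2 ^ (k + 1) * h ^ (s' + t) * A) := by ring

variable {V : Type*} {G : SimpleGraph V}

theorem stepMatrix_nonneg (G : SimpleGraph V) (o : V) (s : ℕ × ℕ) (y w : V) :
    0 ≤ stepMatrix G o s y w := by
  rw [stepMatrix, of_apply]
  positivity

variable [Fintype V] [DecidableEq V]

theorem walkMatrix_nil (G : SimpleGraph V) (o : V) : walkMatrix G o [] = 1 := rfl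

theorem walkMatrix_cons (G : SimpleGraph V) (o : V) (s : ℕ × ℕ) (L : List (ℕ × ℕ)) :
    walkMatrix G o (s :: L) = stepMatrix G o s * walkMatrix G o L := by
  rw [walkMatrix, List.map_cons, List.prod_cons, walkMatrix]

theorem walkMatrix_concat (G : SimpleGraph V) (o : V) (L : List (ℕ × ℕ)) (s : ℕ × ℕ) :
    walkMatrix G o (L ++ [s]) = walkMatrix G o L * stepMatrix G o s := by
  rw [walkMatrix, List.map_append, List.prod_append, List.map_singleton, List.prod_singleton,
    walkMatrix]

theorem walkMatrix_nonneg (G : SimpleGraph V) (o : V) (L : List (ℕ × ℕ)) (y z : V) :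
    0 ≤ walkMatrix G o L y z := by
  induction L generalizing y with
  | nil =>
    rw [walkMatrix_nil, one_apply]
    positivity
  | cons s L ih =>
    rw [walkMatrix_cons, mul_apply]
    exact sum_nonneg fun w _ => mul_nonneg (stepMatrix_nonneg G o s y w) (ih w)

theorem walkMatrix_pair (o : V) (u u' t : ℕ) {s' : ℕ} (y : V) {z : V} (hz : G.dist o z = s') :
    walkMatrix G o [(u, t), (u', s')] y z =
      #{w | G.dist o w = t ∧ G.dist y w = u ∧ G.dist z w = u'} := by
  rw [walkMatrix_cons, walkMatrix_cons, walkMatrix_nil, mul_one, mul_apply, ← sum_boole]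
  refine sum_congr rfl fun w _ => ?_
  simp only [stepMatrix, of_apply, hz, true_and, G.dist_comm (u := w), mul_ite, mul_one, mul_zero]
  split_ifs <;> first | rfl | tauto

variable [DecidableRel G.Adj] {g d : ℕ}

theorem isSpreading_pair (hc : G.Connected) (hg : (g : ℕ∞) < G.egirth)
    (hreg : G.IsRegularOfDegree d) (hd : 3 ≤ d) (o : V) {s s' t u u' : ℕ} (hu : u = s + t)
    (hu' : u' = s' + t) (hug : 2 * u ≤ g) (hug' : 2 * u' ≤ g) :
    IsSpreading G d o [(u, t), (u', s')] s s' := by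
  rintro y z rfl hz
  subst hu hu'
  have hcard := pow_le_two_mul_card_opposite hc hg hreg hd (t := t) hug (hz ▸ hug')
  rw [hz] at hcard
  rw [walkMatrix_pair o _ _ _ _ hz]
  have hpos := rootGrowth_pos hd
  have hcard' : rootGrowth d ^ (2 * t) ≤
      2 * #{w | G.dist o w = t ∧ G.dist y w = G.dist o y + t ∧ G.dist z w = s' + t} := by
    rw [rootGrowth_pow_two_mul]
    exact_mod_cast hcard
  simp only [List.map_cons, List.map_nil, List.sum_cons, List.sum_nil, List.length_cons,
    List.length_nil]
  set n := #{w | G.dist o w = t ∧ G.dist y w = G.dist o y + t ∧ G.dist z w = s' + t}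
  calc rootGrowth d ^ (G.dist o y + t + (s' + t + 0))
      = rootGrowth d ^ (G.dist o y + s') * rootGrowth d ^ (2 * t) := by ring
    _ ≤ rootGrowth d ^ (G.dist o y + s') * (2 * n) := by gcongr
    _ ≤ rootGrowth d ^ (G.dist o y + s') * (4 * n) := by gcongr; norm_num
    _ = _ := by ring

theorem IsSpreading.cons (hc : G.Connected) (hg : (g : ℕ∞) < G.egirth)
    (hreg : G.IsRegularOfDegree d) (hd : 3 ≤ d) {o : V} {L : List (ℕ × ℕ)} {s t u s' : ℕ}
    (hL : IsSpreading G d o L s t) (ht : IsTreeTriangle s' s u) (hper : s' + s + u ≤ g) :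
    IsSpreading G d o ((u, s) :: L) s' t := by
  rintro y z rfl hz
  have hlow := pow_le_triangleCount hd ht
  rw [← card_triangle hc hg hreg ht.even hper] at hlow
  set S : Finset V := {w | G.dist o w = s ∧ G.dist y w = u}
  have hsum : ∑ w ∈ S, walkMatrix G o L w z = walkMatrix G o ((u, s) :: L) y z := by
    rw [walkMatrix_cons, mul_apply, sum_filter]
    exact sum_congr rfl fun w _ => by simp [stepMatrix]
  have hS : #S * rootGrowth d ^ (L.map Prod.fst).sum ≤
      2 ^ L.length * rootGrowth d ^ (s + t) * walkMatrix G o ((u, s) :: L) y z := by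
    rw [← hsum, mul_sum, ← nsmul_eq_mul, ← sum_const]
    exact sum_le_sum fun w hw => hL w z (mem_filter.mp hw).2.1 hz
  rw [List.map_cons, List.sum_cons, List.length_cons]
  exact pow_add_le_of_mul_le (rootGrowth_pos hd) hlow hS

theorem IsSpreading.concat (hc : G.Connected) (hg : (g : ℕ∞) < G.egirth)
    (hreg : G.IsRegularOfDegree d) (hd : 3 ≤ d) {o : V} {L : List (ℕ × ℕ)} {s t u t' : ℕ}
    (hL : IsSpreading G d o L s t) (ht : IsTreeTriangle t' t u) (hper : t' + t + u ≤ g) :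
    IsSpreading G d o (L ++ [(u, t')]) s t' := by
  rintro y z hy rfl
  have hlow := pow_le_triangleCount hd ht
  rw [← card_triangle hc hg hreg ht.even hper] at hlow
  set S : Finset V := {w | G.dist o w = t ∧ G.dist z w = u}
  have hsum : ∑ w ∈ S, walkMatrix G o L y w ≤ walkMatrix G o (L ++ [(u, G.dist o z)]) y z := by
    rw [walkMatrix_concat, mul_apply, sum_filter]
    refine sum_le_sum fun w _ => ?_
    split_ifs with hw
    · simp [stepMatrix, G.dist_comm (u := w), hw.2]
    · exact mul_nonneg (walkMatrix_nonneg G o L y w) (stepMatrix_nonneg G o _ w z)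
  have hpos := rootGrowth_pos hd
  have hS : #S * rootGrowth d ^ (L.map Prod.fst).sum ≤
      2 ^ L.length * rootGrowth d ^ (t + s) * walkMatrix G o (L ++ [(u, G.dist o z)]) y z := by
    refine le_trans ?_ (mul_le_mul_of_nonneg_left hsum (by positivity))
    rw [mul_sum, ← nsmul_eq_mul, ← sum_const, add_comm t]
    exact sum_le_sum fun w hw => hL y w hy (mem_filter.mp hw).2.1
  rw [List.map_append, List.sum_append, List.map_singleton, List.sum_singleton, add_comm _ u,
    add_comm s, List.length_append, List.length_singleton]
  exact pow_add_le_of_mul_le hpos hlow hS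

end Spreading

section LinkWalks

variable {V : Type*} {G : SimpleGraph V} {m : ℕ} {s : Fin m → ℕ}

theorem prod_stepMatrix (x y w : Fin m → V) (τ : (Fin m → ℕ) × (Fin m → ℕ)) :
    ∏ i, stepMatrix G (x i) (τ.1 i, τ.2 i) (y i) (w i) =
      if (fun i => G.dist (x i) (w i)) = τ.2 ∧ (fun i => G.dist (y i) (w i)) = τ.1
      then 1 else 0 := by
  simp only [stepMatrix, of_apply, prod_ite_zero, prod_const_one, mem_univ, forall_const,
    forall_and, funext_iff]

variable [Fintype V]

open Classical in
theorem prod_walkMatrix_le_link_pow (hs : s ≠ 0) (x : Fin m → V)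
    (L : List ((Fin m → ℕ) × (Fin m → ℕ)))
    (hL : ∀ τ ∈ L, τ.1 ∈ arrangements s ∧ τ.2 ∈ arrangements s)
    (y z : (tuplePolygraph G s).neighborSet x) :
    ∏ i, walkMatrix G (x i) (L.map fun τ => (τ.1 i, τ.2 i)) (y.1 i) (z.1 i) ≤
      ((link (tuplePolygraph G s) x).adjMatrix ℝ ^ L.length) y z := by
  induction L generalizing y with
  | nil =>
    simp only [List.map_nil, walkMatrix_nil, List.length_nil, pow_zero, one_apply, prod_ite_zero,
      prod_const_one, mem_univ, forall_const, ← funext_iff, Subtype.ext_iff, le_refl]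
  | cons τ L ih =>
    obtain ⟨⟨hτ₁, hτ₂⟩, hL'⟩ := List.forall_mem_cons.mp hL
    simp only [List.map_cons, walkMatrix_cons, List.length_cons, pow_succ', mul_apply]
    rw [prod_univ_sum, Fintype.piFinset_univ]
    simp_rw [prod_mul_distrib, prod_stepMatrix]
    rw [← Fintype.sum_of_injective Subtype.val Subtype.val_injective (fun w => _) _ ?_
      fun w : (tuplePolygraph G s).neighborSet x => rfl]
    · refine sum_le_sum fun w _ => ?_
      split_ifs with hw
      · rw [one_mul, SimpleGraph.adjMatrix_apply, if_pos, one_mul]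
        · exact ih hL' w
        · exact (tuplePolygraph_adj_iff hs).mpr (hw.2 ▸ hτ₁)
      · rw [zero_mul]
        have hpow := (prod_nonneg fun i _ => walkMatrix_nonneg G (x i) _ _ _).trans (ih hL' w)
        rw [SimpleGraph.adjMatrix_apply]
        positivity
    · intro w hw
      rw [Subtype.range_coe] at hw
      rw [if_neg, zero_mul]
      exact fun h => hw ((tuplePolygraph_adj_iff hs).mpr (h.1 ▸ hτ₂))

theorem sum_walk_lengths {L : List ((Fin m → ℕ) × (Fin m → ℕ))}
    (hL : ∀ τ ∈ L, τ.1 ∈ arrangements s) :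
    ∑ i, ((L.map fun τ => (τ.1 i, τ.2 i)).map Prod.fst).sum = L.length * ∑ i, s i := by
  induction L with
  | nil => simp
  | cons τ L ih =>
    obtain ⟨hτ, hL'⟩ := List.forall_mem_cons.mp hL
    simp only [List.map_cons, List.sum_cons, sum_add_distrib, ih hL', List.length_cons]
    rw [sum_of_mem_arrangements (fun k => k) hτ]
    ring

open Classical in
theorem pow_le_link_pow (hs : s ≠ 0) {d : ℕ} {x : Fin m → V}
    {L : List ((Fin m → ℕ) × (Fin m → ℕ))}
    (hL : ∀ τ ∈ L, τ.1 ∈ arrangements s ∧ τ.2 ∈ arrangements s)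
    {y z : (tuplePolygraph G s).neighborSet x}
    (hspread : ∀ i, IsSpreading G d (x i) (L.map fun τ => (τ.1 i, τ.2 i))
      (G.dist (x i) (y.1 i)) (G.dist (x i) (z.1 i))) :
    (rootGrowth d ^ ∑ i, s i) ^ L.length ≤
      (2 ^ m) ^ L.length * rootGrowth d ^ (2 * ∑ i, s i) *
        ((link (tuplePolygraph G s) x).adjMatrix ℝ ^ L.length) y z := by
  have hpos : 0 ≤ rootGrowth d := Real.sqrt_nonneg _
  have hyz (w : (tuplePolygraph G s).neighborSet x) :
      ∑ i, G.dist (x i) (w.1 i) = ∑ i, s i :=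
    sum_of_mem_arrangements (fun k => k) ((tuplePolygraph_adj_iff hs).mp w.2)
  have hprod := prod_le_prod (s := univ) (fun i _ => by positivity)
    fun i _ => hspread i (y.1 i) (z.1 i) rfl rfl
  simp only [prod_mul_distrib, prod_pow_eq_pow_sum, sum_walk_lengths fun τ hτ => (hL τ hτ).1,
    sum_add_distrib, hyz, List.length_map, sum_const, card_univ, Fintype.card_fin, smul_eq_mul,
    ← two_mul] at hprod
  rw [mul_comm L.length, pow_mul, pow_mul 2] at hprod
  exact hprod.trans <| mul_le_mul_of_nonneg_left (prod_walkMatrix_le_link_pow hs x L hL y z)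
    (by positivity)

/-- A lower bound, independent of the degree of the graph, for the spectral gap of the links of the
polygraph of `s` when any two vertices of a link are joined by spreading walks of `n` steps. -/
noncomputable def linkGap {m : ℕ} (s : Fin m → ℕ) (n : ℕ) : ℝ :=
  1 / (2 ^ m * (#(arrangements s) ^ 2 * 2 ^ m)) ^ n / n

theorem linkGap_pos (s : Fin m → ℕ) {n : ℕ} (hn : 0 < n) : 0 < linkGap s n := by
  have harr := card_arrangements_pos s
  rw [linkGap]
  positivity

open Classical in
theorem card_neighborSet_tuplePolygraph [DecidableRel G.Adj] {g d : ℕ} (hc : G.Connected)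
    (hg : (g : ℕ∞) < G.egirth) (hreg : G.IsRegularOfDegree d) (hs : s ≠ 0)
    (hsg : ∀ i, 2 * s i ≤ g) (x : Fin m → V) :
    Fintype.card ((tuplePolygraph G s).neighborSet x) = polygraphDegree s d := by
  rw [← polygraph_isRegularOfDegree hc hg hreg hs hsg x, SimpleGraph.card_neighborSet_eq_degree]

open Classical in
theorem link_isSpectralExpander_of_isSpreading [DecidableRel G.Adj] {g d n : ℕ}
    (hc : G.Connected) (hg : (g : ℕ∞) < G.egirth) (hreg : G.IsRegularOfDegree d) (hd : 3 ≤ d)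
    (hs : s ≠ 0) (heven : ∀ i, Even (s i)) (hsg : ∀ i, 3 * s i ≤ g) {x : Fin m → V} (hn : 0 < n)
    (hspread : ∀ y z : (tuplePolygraph G s).neighborSet x,
      ∃ L : List ((Fin m → ℕ) × (Fin m → ℕ)), L.length = n ∧
        (∀ τ ∈ L, τ.1 ∈ arrangements s ∧ τ.2 ∈ arrangements s) ∧
        ∀ i, IsSpreading G d (x i) (L.map fun τ => (τ.1 i, τ.2 i))
          (G.dist (x i) (y.1 i)) (G.dist (x i) (z.1 i))) :
    IsSpectralExpander (link (tuplePolygraph G s) x) (polygraphLinkDegree s d) (linkGap s n) := by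
  have hbpos := polygraphLinkDegree_pos hd heven
  have hlink := link_isRegularOfDegree hc hg hreg hs heven hsg x
  refine ⟨hbpos, by convert hlink, ?_⟩
  have hh := rootGrowth_pos hd
  have harr : (1 : ℝ) ≤ #(arrangements s) := by exact_mod_cast card_arrangements_pos s
  rw [linkGap]
  set C : ℝ := #(arrangements s) ^ 2 * 2 ^ m
  set D : ℝ := 2 ^ m
  set H := rootGrowth d ^ ∑ i, s i with hH
  have hC1 : 1 ≤ C := one_le_mul_of_one_le_of_one_le (one_le_pow₀ harr) (one_le_pow₀ one_le_two)
  have hb : (polygraphLinkDegree s d : ℝ) ≤ C * H := polygraphLinkDegree_le hd heven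
  have hN : H ^ 2 ≤ polygraphDegree s d := by
    rw [hH, ← pow_mul, mul_comm]
    exact pow_le_polygraphDegree s d
  have hlow (y z : (tuplePolygraph G s).neighborSet x) :
      H ^ n / (D ^ n * H ^ 2) ≤ ((link (tuplePolygraph G s) x).adjMatrix ℝ ^ n) y z := by
    obtain ⟨L, rfl, hL, hLspread⟩ := hspread y z
    rw [div_le_iff₀ (by positivity), mul_comm, hH, ← pow_mul _ _ 2, mul_comm _ 2]
    exact pow_le_link_pow hs hL hLspread
  have hbound := adjEigenvalue_two_le_of_pow (δ := 1 / (D * C) ^ n) hlink hn ?_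
    (fun y z => by convert hlow y z) ?_
  · rwa [le_sub_comm, div_le_iff₀ (by exact_mod_cast hbpos)]
  · rw [div_le_one (by positivity)]
    exact one_le_pow₀ (one_le_mul_of_one_le_of_one_le (one_le_pow₀ one_le_two) hC1)
  · calc 1 / (D * C) ^ n * (polygraphLinkDegree s d : ℝ) ^ n ≤ 1 / (D * C) ^ n * (C * H) ^ n := by
          gcongr
      _ = H ^ n / (D ^ n * H ^ 2) * H ^ 2 := by
          have hC0 : C ≠ 0 := by positivity
          have hH0 : H ≠ 0 := by positivity
          clear_value C D H
          rw [mul_pow, mul_pow]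
          field_simp
      _ ≤ _ := by
          rw [card_neighborSet_tuplePolygraph hc hg hreg hs (fun i => by linarith [hsg i])]
          gcongr

end LinkWalks

section TripleSteps

variable {p q : ℕ}

theorem arrangements_triple (a b c : ℕ) :
    arrangements ![a, b, c] =
      {![a, b, c], ![a, c, b], ![b, a, c], ![b, c, a], ![c, a, b], ![c, b, a]} := by
  have hperm : (univ : Finset (Equiv.Perm (Fin 3))) = {1, Equiv.swap 1 2, Equiv.swap 0 1,
      finRotate 3, (finRotate 3).symm, Equiv.swap 0 2} := by
    decide
  have hcomp (π : Equiv.Perm (Fin 3)) :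
      ![a, b, c] ∘ π = ![![a, b, c] (π 0), ![a, b, c] (π 1), ![a, b, c] (π 2)] := by
    ext i
    fin_cases i <;> rfl
  simp only [arrangements, hperm, image_insert, image_singleton, hcomp]
  rfl

theorem exists_arrangement_forall_isTreeTriangle (hp : Even p) (hq : Even q) (hpq : p ≤ q)
    {τ : Fin 3 → ℕ} (hτ : τ ∈ arrangements ![p, q, p + q]) :
    ∃ ω ∈ arrangements ![p, q, p + q], ∀ r, IsTreeTriangle (τ r) (![p, p + q, q] r) (ω r) := by
  have htri {i j k : ℕ} (hi : Even i) (hj : Even j) (hk : Even k) (h₁ : i ≤ j + k)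
      (h₂ : j ≤ i + k) (h₃ : k ≤ i + j) : IsTreeTriangle i j k :=
    ⟨(hi.add hj).add hk, h₁, h₂, h₃⟩
  have hpq' := hp.add hq
  simp only [arrangements_triple, mem_insert, mem_singleton] at hτ ⊢
  rcases hτ with rfl | rfl | rfl | rfl | rfl | rfl
  on_goal 1 => refine ⟨![p, q, p + q], by simp, fun r => ?_⟩
  on_goal 2 => refine ⟨![p, p + q, q], by simp, fun r => ?_⟩
  on_goal 3 => refine ⟨![p + q, q, p], by simp, fun r => ?_⟩
  on_goal 4 => refine ⟨![q, p, p + q], by simp, fun r => ?_⟩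
  on_goal 5 => refine ⟨![q, p + q, p], by simp, fun r => ?_⟩
  on_goal 6 => refine ⟨![q, p, p + q], by simp, fun r => ?_⟩
  all_goals fin_cases r <;> apply htri <;> simp [*] <;> lia

/-- Steps in a link of the polygraph of `![p, q, p + q]`, given by the lengths of the coordinate
steps and the arrangement of distances that is reached. Every coordinate makes two consecutive steps
of length `p + q`, through distances `p` and `q`, which lead to all vertices of the sphere; the last
step reaches `τ`. -/
def refreshingSteps (p q : ℕ) (ω τ : Fin 3 → ℕ) : List ((Fin 3 → ℕ) × (Fin 3 → ℕ)) :=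
  [(![p + q, q, p], ![q, p, p + q]), (![p + q, q, p], ![p, q, p + q]),
    (![q, p + q, p], ![q, p, p + q]), (![q, p + q, p], ![p, q, p + q]),
    (![p, q, p + q], ![p, p + q, q]), (![q, p, p + q], ![q, p + q, p]),
    (![q, p, p + q], ![p, p + q, q]), (ω, τ)]

theorem mem_arrangements_of_mem_refreshingSteps {ω τ : Fin 3 → ℕ}
    (hω : ω ∈ arrangements ![p, q, p + q]) (hτ : τ ∈ arrangements ![p, q, p + q])
    {σ : (Fin 3 → ℕ) × (Fin 3 → ℕ)} (hσ : σ ∈ refreshingSteps p q ω τ) :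
    σ.1 ∈ arrangements ![p, q, p + q] ∧ σ.2 ∈ arrangements ![p, q, p + q] := by
  rw [refreshingSteps, List.mem_cons, List.mem_cons, List.mem_cons, List.mem_cons, List.mem_cons,
    List.mem_cons, List.mem_cons, List.mem_singleton] at hσ
  rcases hσ with rfl | rfl | rfl | rfl | rfl | rfl | rfl | rfl
  case inr.inr.inr.inr.inr.inr.inr => exact ⟨hω, hτ⟩
  all_goals simp [arrangements_triple]

variable {V : Type*} [Fintype V] [DecidableEq V] {G : SimpleGraph V} [DecidableRel G.Adj]
  {g d : ℕ} {ω τ : Fin 3 → ℕ}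

theorem isSpreading_refreshingSteps (hc : G.Connected) (hg : (g : ℕ∞) < G.egirth)
    (hreg : G.IsRegularOfDegree d) (hd : 3 ≤ d) (hp : Even p) (hq : Even q) (hpq : p ≤ q)
    (hpqg : 3 * (p + q) ≤ g) (o : V)
    (hω : ∀ r, IsTreeTriangle (τ r) (![p, p + q, q] r) (ω r))
    (hper : ∀ r, τ r + ![p, p + q, q] r + ω r ≤ g) (r : Fin 3) :
    IsSpreading G d o ((refreshingSteps p q ω τ).map fun σ => (σ.1 r, σ.2 r))
      (![p, q, p + q] r) (τ r) := by
  have hcons {L : List (ℕ × ℕ)} {s t : ℕ} (u s' : ℕ) (hL : IsSpreading G d o L s t)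
      (heven : Even (s' + s + u)) (h : s' ≤ s + u ∧ s ≤ s' + u ∧ u ≤ s' + s ∧ s' + s + u ≤ g) :
      IsSpreading G d o ((u, s) :: L) s' t :=
    hL.cons hc hg hreg hd ⟨heven, h.1, h.2.1, h.2.2.1⟩ h.2.2.2
  have hconcat {L : List (ℕ × ℕ)} {s t : ℕ} (u t' : ℕ) (hL : IsSpreading G d o L s t)
      (heven : Even (t' + t + u)) (h : t' ≤ t + u ∧ t ≤ t' + u ∧ u ≤ t' + t ∧ t' + t + u ≤ g) :
      IsSpreading G d o (L ++ [(u, t')]) s t' :=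
    hL.concat hc hg hreg hd ⟨heven, h.1, h.2.1, h.2.2.1⟩ h.2.2.2
  fin_cases r
  · have h : IsSpreading G d o [(p + q, q), (p + q, p)] p p :=
      isSpreading_pair hc hg hreg hd o rfl rfl (by lia) (by lia)
    replace h := hconcat q q h (by grind) (by lia)
    replace h := hconcat q p h (by grind) (by lia)
    replace h := hconcat p p h (by grind) (by lia)
    replace h := hconcat q q h (by grind) (by lia)
    replace h := hconcat q p h (by grind) (by lia)
    exact h.concat hc hg hreg hd (hω 0) (hper 0)
  · have h : IsSpreading G d o [(p + q, p), (p + q, q)] q q :=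
      isSpreading_pair hc hg hreg hd o (by lia) (by lia) (by lia) (by lia)
    replace h := hcons q p h (by grind) (by lia)
    replace h := hcons q q h (by grind) (by lia)
    replace h := hconcat q (p + q) h (by grind) (by lia)
    replace h := hconcat p (p + q) h (by grind) (by lia)
    replace h := hconcat p (p + q) h (by grind) (by lia)
    exact h.concat hc hg hreg hd (hω 1) (hper 1)
  · have h : IsSpreading G d o [(p + q, p), (p + q, q)] q q :=
      isSpreading_pair hc hg hreg hd o (by lia) (by lia) (by lia) (by lia)
    replace h := hcons (p + q) (p + q) h (by grind) (by lia)
    replace h := hcons p (p + q) h (by grind) (by lia)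
    replace h := hcons p (p + q) h (by grind) (by lia)
    replace h := hcons p (p + q) h (by grind) (by lia)
    replace h := hcons p (p + q) h (by grind) (by lia)
    exact h.concat hc hg hreg hd (hω 2) (hper 2)

end TripleSteps

section TripleLinks

variable {p q : ℕ}

theorem triple_ne_zero (hq : 0 < q) : ![p, q, p + q] ≠ 0 :=
  fun h => hq.ne' (congrFun h 1)

theorem triple_le_add (p q : ℕ) (i : Fin 3) : ![p, q, p + q] i ≤ p + q := by
  fin_cases i <;> simp

theorem even_triple (hp : Even p) (hq : Even q) (i : Fin 3) : Even (![p, q, p + q] i) := by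
  fin_cases i <;> simp [hp, hq, hp.add hq]

open Classical in
theorem polygraph_isLocalSpectralExpander {V : Type*} [Fintype V] {G : SimpleGraph V}
    [DecidableRel G.Adj] {g d : ℕ} (hc : G.Connected) (hg : (g : ℕ∞) < G.egirth)
    (hreg : G.IsRegularOfDegree d) (hd : 3 ≤ d) (hp : Even p) (hq : Even q) (hpq : p ≤ q)
    (hq0 : 0 < q) (hpqg : 3 * (p + q) ≤ g) :
    IsLocalSpectralExpander (tuplePolygraph G ![p, q, p + q]) (polygraphLinkDegree ![p, q, p + q] d)
      (linkGap ![p, q, p + q] 8) := by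
  intro x
  have hs : ![p, q, p + q] ≠ 0 := triple_ne_zero hq0
  refine link_isSpectralExpander_of_isSpreading hc hg hreg hd hs (even_triple hp hq)
    (fun i => by linarith [triple_le_add p q i]) (by norm_num) fun y z => ?_
  obtain ⟨π, hπ⟩ := mem_arrangements_iff_exists_perm.mp ((tuplePolygraph_adj_iff hs).mp y.2)
  have hτ := comp_perm_mem_arrangements ((tuplePolygraph_adj_iff hs).mp z.2) π.symm
  set τ := (fun i => G.dist (x i) (z.1 i)) ∘ π.symm with hτz
  obtain ⟨ω, hω, htri⟩ := exists_arrangement_forall_isTreeTriangle hp hq hpq hτ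
  refine ⟨(refreshingSteps p q ω τ).map fun σ => (σ.1 ∘ π, σ.2 ∘ π), rfl, ?_, fun i => ?_⟩
  · intro σ hσ
    obtain ⟨ρ, hρ, rfl⟩ := List.mem_map.mp hσ
    have h := mem_arrangements_of_mem_refreshingSteps hω hτ hρ
    exact ⟨comp_perm_mem_arrangements h.1 π, comp_perm_mem_arrangements h.2 π⟩
  · have hper (r : Fin 3) : τ r + ![p, p + q, q] r + ω r ≤ g := by
      have hτr : τ r ≤ p + q :=
        forall_of_mem_arrangements (P := (· ≤ p + q)) (triple_le_add p q) hτ r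
      have hωr : ω r ≤ p + q :=
        forall_of_mem_arrangements (P := (· ≤ p + q)) (triple_le_add p q) hω r
      have hr : ![p, p + q, q] r ≤ p + q := by fin_cases r <;> simp
      lia
    have h := isSpreading_refreshingSteps hc hg hreg hd hp hq hpq hpqg (x i) htri hper (π i)
    have hyi : ![p, q, p + q] (π i) = G.dist (x i) (y.1 i) := congrFun hπ i
    have hzi : τ (π i) = G.dist (x i) (z.1 i) := by simp [hτz]
    rw [hyi, hzi] at h
    simpa only [List.map_map, Function.comp_def] using h

end TripleLinks

section PolygraphSpectrum

theorem spectralGap_le_one {V : Type*} [Fintype V] (G : SimpleGraph V) (d : ℕ) :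
    spectralGap G d ≤ 1 := by
  have hmax : 0 ≤ lambdaMax G := by
    by_cases h : 2 ≤ Fintype.card V
    · exact (abs_nonneg _).trans (abs_eigenvalues_eigenIndex_le_lambdaMax (k := ⟨1, h⟩) le_rfl)
    · exact le_max_of_le_left (by rw [adjEigenvalue, dif_neg fun h' => h h'.2])
  rw [spectralGap]
  linarith [div_nonneg hmax d.cast_nonneg]

theorem eq_zero_of_forall_sum_prod_eq_zero {V ι : Type*} [Fintype V] {f : ι → V → ℝ}
    (hf : ∀ g : V → ℝ, (∀ j, f j ⬝ᵥ g = 0) → g = 0) {m : ℕ} {F : (Fin m → V) → ℝ}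
    (h : ∀ J : Fin m → ι, ∑ y, (∏ i, f (J i) (y i)) * F y = 0) : F = 0 := by
  induction m with
  | zero =>
    ext y
    simpa [Subsingleton.elim y default] using h Fin.elim0
  | succ m ih =>
    have hslice (J : Fin m → ι) (a : V) :
        ∑ y, (∏ i, f (J i) (y i)) * F (Fin.cons a y) = 0 := by
      refine congrFun (hf (fun a => ∑ y, (∏ i, f (J i) (y i)) * F (Fin.cons a y)) fun j => ?_) a
      rw [dotProduct, ← h (Fin.cons j J), ← (Fin.consEquiv fun _ => V).sum_comp,
        Fintype.sum_prod_type]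
      refine sum_congr rfl fun a _ => ?_
      rw [mul_sum]
      refine sum_congr rfl fun y _ => ?_
      simp [Fin.consEquiv, Fin.prod_univ_succ, mul_assoc]
    ext y
    simpa using congrFun (ih fun J => hslice J (y 0)) (Fin.tail y)

variable {m : ℕ} {s : Fin m → ℕ}

theorem sum_arrangements_prod_le {φ : Fin m → ℕ → ℝ} {c : ℝ} (hφ : ∀ i r, |φ i r| ≤ 1)
    {i₀ : Fin m} (hi₀ : ∀ r, |φ i₀ (r + 1)| ≤ c) (hs : s ≠ 0) :
    ∑ u ∈ arrangements s, ∏ i, φ i (u i) ≤ #(arrangements s) - (1 - c) := by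
  have hprod (u : Fin m → ℕ) : ∏ i, φ i (u i) ≤ |φ i₀ (u i₀)| := by
    refine (le_abs_self _).trans ?_
    rw [abs_prod, ← mul_prod_erase univ _ (mem_univ i₀)]
    exact mul_le_of_le_one_right (abs_nonneg _)
      (prod_le_one (fun _ _ => abs_nonneg _) fun i _ => hφ i _)
  obtain ⟨k, hk⟩ := Function.ne_iff.mp hs
  set u₀ := s ∘ Equiv.swap i₀ k with hu₀
  have hmem : u₀ ∈ arrangements s := comp_perm_mem_arrangements (self_mem_arrangements s) _
  have hgain : |φ i₀ (u₀ i₀)| ≤ c := by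
    rw [hu₀, Function.comp_apply, Equiv.swap_apply_left,
      ← Nat.sub_add_cancel (Nat.one_le_iff_ne_zero.mpr hk)]
    exact hi₀ _
  calc ∑ u ∈ arrangements s, ∏ i, φ i (u i)
      = ∏ i, φ i (u₀ i) + ∑ u ∈ (arrangements s).erase u₀, ∏ i, φ i (u i) :=
        (add_sum_erase _ _ hmem).symm
    _ ≤ c + ∑ u ∈ (arrangements s).erase u₀, 1 :=
        add_le_add ((hprod u₀).trans hgain)
          (sum_le_sum fun u _ => (hprod u).trans (hφ i₀ _))
    _ = #(arrangements s) - (1 - c) := by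
        rw [sum_const, card_erase_of_mem hmem, nsmul_one, Nat.cast_pred (card_arrangements_pos s)]
        ring

variable {V : Type*} [Fintype V] {G : SimpleGraph V} {g d : ℕ}

open Classical in
theorem tuplePolygraph_mulVec_prod [DecidableRel G.Adj] (hc : G.Connected)
    (hg : (g : ℕ∞) < G.egirth) (hreg : G.IsRegularOfDegree d) (hd : 3 ≤ d) (hs : s ≠ 0)
    (hsg : ∀ i, 2 * s i ≤ g) {f : Fin m → V → ℝ} {μ : Fin m → ℝ}
    (hf : ∀ i, G.adjMatrix ℝ *ᵥ f i = μ i • f i) :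
    (tuplePolygraph G s).adjMatrix ℝ *ᵥ (fun y => ∏ i, f i (y i)) =
      ((∏ i, (sphereCount d (s i) : ℝ)) *
        ∑ u ∈ arrangements s, ∏ i, sphericalValue (d : ℝ)⁻¹ (μ i / d) (u i)) •
          (fun y => ∏ i, f i (y i)) := by
  ext x
  rw [SimpleGraph.adjMatrix_mulVec_apply, SimpleGraph.neighborFinset_eq_filter]
  simp_rw [tuplePolygraph_adj_iff hs]
  rw [sum_arrangements_fiberwise, Pi.smul_apply, smul_eq_mul, mul_sum, sum_mul]
  refine sum_congr rfl fun u hu => ?_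
  have hfiber : ({y | (fun i => G.dist (x i) (y i)) = u} : Finset (Fin m → V)) =
      Fintype.piFinset fun i => ({v | G.dist (x i) v = u i} : Finset V) := by
    ext y
    simp [funext_iff]
  rw [hfiber, ← prod_univ_sum (fun i => ({v | G.dist (x i) v = u i} : Finset V)) fun i v => f i v,
    ← prod_of_mem_arrangements (fun r => (sphereCount d r : ℝ)) hu, ← prod_mul_distrib,
    ← prod_mul_distrib]
  exact prod_congr rfl fun i _ => sum_sphere_eigenvector hc hg hreg hd (hf i) (x i)
    (forall_of_mem_arrangements (P := fun k => 2 * k ≤ g) hsg hu i)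

theorem sum_prod_sphericalValue_le (hd : 3 ≤ d) {γ : ℝ} (hγ : 0 < γ) {μ : Fin m → ℝ}
    (hμ : ∀ i, |μ i| ≤ (1 - γ) * d ∨ μ i = d) {i₀ : Fin m} (hi₀ : |μ i₀| ≤ (1 - γ) * d)
    (hs : s ≠ 0) :
    ∑ u ∈ arrangements s, ∏ i, sphericalValue (d : ℝ)⁻¹ (μ i / d) (u i) ≤
      #(arrangements s) - 3 / 8 * γ := by
  have hd0 : (0 : ℝ) < d := by positivity
  have hθ0 : (0 : ℝ) ≤ (d : ℝ)⁻¹ := by positivity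
  have hθ : (d : ℝ)⁻¹ ≤ 1 / 3 := by
    rw [one_div]
    gcongr
    exact_mod_cast hd
  have hdiv {i : Fin m} (hi : |μ i| ≤ (1 - γ) * d) : |μ i / d| ≤ 1 - γ := by
    rwa [abs_div, abs_of_pos hd0, div_le_iff₀ hd0]
  have hone (i : Fin m) (r : ℕ) : |sphericalValue (d : ℝ)⁻¹ (μ i / d) r| ≤ 1 := by
    rcases hμ i with h | h
    · exact abs_sphericalValue_le_one hθ0 hθ hγ (hdiv h) r
    · rw [h, div_self hd0.ne', sphericalValue_one hθ, abs_one]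
  linarith [sum_arrangements_prod_le hone (abs_sphericalValue_succ_le hθ0 hθ hγ (hdiv hi₀)) hs]

open Classical in
theorem exists_eigenvalue_tuplePolygraph_eq (hc : G.Connected) (hg : (g : ℕ∞) < G.egirth)
    (hreg : G.IsRegularOfDegree d) (hd : 3 ≤ d) (hs : s ≠ 0) (hsg : ∀ i, 2 * s i ≤ g)
    {γ : ℝ} (hγ : 0 < γ) (hle : γ ≤ spectralGap G d) {F : (Fin m → V) → ℝ} {ν : ℝ} (hF0 : F ≠ 0)
    (hFsum : ∑ y, F y = 0) (hF : (tuplePolygraph G s).adjMatrix ℝ *ᵥ F = ν • F) :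
    ∃ μ : Fin m → ℝ, (∀ i, |μ i| ≤ (1 - γ) * d ∨ μ i = d) ∧ (∃ i, |μ i| ≤ (1 - γ) * d) ∧
      ν = (∏ i, (sphereCount d (s i) : ℝ)) *
        ∑ u ∈ arrangements s, ∏ i, sphericalValue (d : ℝ)⁻¹ (μ i / d) (u i) := by
  have A := G.isHermitian_adjMatrix ℝ
  obtain ⟨J, hJ⟩ : ∃ J : Fin m → V, ∑ y, (∏ i, A.eigenvectorBasis (J i) (y i)) * F y ≠ 0 := by
    by_contra! h
    exact hF0 (eq_zero_of_forall_sum_prod_eq_zero (f := fun j => ⇑(A.eigenvectorBasis j))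
      (fun _ => eq_zero_of_forall_eigenvectorBasis_dotProduct) h)
  have hdich (i : Fin m) := abs_eigenvalues_le_or_eq_degree hreg (by lia) hc hγ hle (J i)
  refine ⟨fun i => A.eigenvalues (J i), fun i => (hdich i).imp_right And.left, ?_, ?_⟩
  · by_contra! h
    have hconst (x y : Fin m → V) :
        ∏ i, A.eigenvectorBasis (J i) (x i) = ∏ i, A.eigenvectorBasis (J i) (y i) :=
      prod_congr rfl fun i _ => ((hdich i).resolve_left (h i).not_ge).2 _ _
    refine hJ ?_
    have := hc.nonempty
    simp_rw [hconst _ fun _ => Classical.arbitrary V, ← mul_sum, hFsum, mul_zero]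
  · have hprod := tuplePolygraph_mulVec_prod hc hg hreg hd hs hsg
      fun i => A.mulVec_eigenvectorBasis (J i)
    have hmul := mul_dotProduct_eq_zero hprod hF
    exact (sub_eq_zero.mp ((mul_eq_zero.mp hmul).resolve_right hJ)).symm

open Classical in
theorem polygraph_isSpectralExpander (hc : G.Connected) (hg : (g : ℕ∞) < G.egirth)
    (hreg : G.IsRegularOfDegree d) (hd : 3 ≤ d) (hs : s ≠ 0) (hsg : ∀ i, 2 * s i ≤ g)
    {γ : ℝ} (hγ : 0 < γ) (hle : γ ≤ spectralGap G d) :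
    IsSpectralExpander (tuplePolygraph G s) (polygraphDegree s d)
      (3 / 8 * γ / #(arrangements s)) := by
  have hpos := polygraphDegree_pos s hd
  have hreg' := polygraph_isRegularOfDegree hc hg hreg hs hsg
  have harr : (1 : ℝ) ≤ #(arrangements s) := by exact_mod_cast card_arrangements_pos s
  have hdegree : (polygraphDegree s d : ℝ) =
      (∏ i, (sphereCount d (s i) : ℝ)) * #(arrangements s) := by
    rw [polygraphDegree, Nat.cast_mul, Nat.cast_prod, mul_comm]
  have hγ1 : γ ≤ 1 := hle.trans (spectralGap_le_one G d)
  refine ⟨hpos, by convert hreg', ?_⟩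
  rw [le_sub_comm, div_le_iff₀ (by exact_mod_cast hpos), hdegree]
  have hθ : (1 - 3 / 8 * γ / #(arrangements s)) *
      ((∏ i, (sphereCount d (s i) : ℝ)) * #(arrangements s)) =
        (∏ i, (sphereCount d (s i) : ℝ)) * (#(arrangements s) - 3 / 8 * γ) := by
    field_simp
  rw [hθ]
  refine adjEigenvalue_two_le hreg' (mul_nonneg (by positivity) (by linarith)) ?_
  intro F ν hF0 hFsum hF
  obtain ⟨μ, hμ, ⟨i₀, hi₀⟩, rfl⟩ :=
    exists_eigenvalue_tuplePolygraph_eq hc hg hreg hd hs hsg hγ hle hF0 hFsum hF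
  gcongr
  exact sum_prod_sphericalValue_le hd hγ hμ hi₀ hs

end PolygraphSpectrum

theorem theorem3_general (p q : ℕ) (hp : Even p) (hq : Even q) (hpq : p ≤ q) (hq0 : 0 < q) :
    ∃ (a b : ℕ → ℕ) (ε : ℝ) (ε' : ℝ → ℝ),
      0 < ε ∧ (∀ γ : ℝ, 0 < γ → 0 < ε' γ) ∧
      ∀ (d : ℕ) (V : Type u) [Fintype V] (G : SimpleGraph V) [DecidableRel G.Adj],
        3 ≤ d → G.IsRegularOfDegree d → G.Connected → ¬ G.IsBipartite →
        ((3 * p + 3 * q : ℕ) : ℕ∞) < G.egirth →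
        let GS : SimpleGraph (Fin 3 → V) := polygraph G {p, q, p + q}
        IsABRegular GS (a d) (b d) ∧
        IsLocalSpectralExpander GS (b d) ε ∧
        0 < spectralGap G d ∧
        ∀ γ : ℝ, 0 < γ → γ ≤ spectralGap G d → IsSpectralExpander GS (a d) (ε' γ) := by
  classical
  set s := ![p, q, p + q]
  refine ⟨polygraphDegree s, polygraphLinkDegree s, linkGap s 8,
    fun γ => 3 / 8 * γ / #(arrangements s), linkGap_pos s (by norm_num), fun γ hγ => ?_, ?_⟩
  · have := card_arrangements_pos s
    positivity
  intro d V _ G _ hd hreg hc hb hg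
  have hs0 : s ≠ 0 := triple_ne_zero hq0
  have hsg (i : Fin 3) : 3 * s i ≤ 3 * p + 3 * q := by linarith [triple_le_add p q i]
  change IsABRegular (tuplePolygraph G s) _ _ ∧ _
  refine ⟨polygraph_isABRegular hc hg hreg hd hs0 (even_triple hp hq) hsg,
    polygraph_isLocalSpectralExpander hc hg hreg hd hp hq hpq hq0 (by lia),
    spectralGap_pos (by convert hreg) (by lia) hc hb, fun γ hγ hle => ?_⟩
  exact polygraph_isSpectralExpander hc hg (by convert hreg) hd hs0 (fun i => by linarith [hsg i])
    hγ hle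

theorem theorem3 (p q : ℕ) (hp : Even p) (hq : Even q) (hpq : p < q) :
    ∃ (a b : ℕ → ℕ) (ε : ℝ) (ε' : ℝ → ℝ),
      0 < ε ∧ (∀ γ : ℝ, 0 < γ → 0 < ε' γ) ∧
      ∀ (d : ℕ) (V : Type u) [Fintype V] (G : SimpleGraph V) [DecidableRel G.Adj],
        3 ≤ d → G.IsRegularOfDegree d → G.Connected → ¬ G.IsBipartite →
        ((3 * p + 3 * q : ℕ) : ℕ∞) < G.egirth →
        let GS : SimpleGraph (Fin 3 → V) := polygraph G {p, q, p + q}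
        IsABRegular GS (a d) (b d) ∧
        IsLocalSpectralExpander GS (b d) ε ∧
        0 < spectralGap G d ∧
        ∀ γ : ℝ, 0 < γ → γ ≤ spectralGap G d → IsSpectralExpander GS (a d) (ε' γ) :=
  theorem3_general p q hp hq hpq.le (pos_of_gt hpq)
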